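/- Let $I\subseteq\mathbb R$ be an open interval and let $f,g,h\colon I\to\mathbb R$ be smooth functions with $g(t)h(t)\neq0$ for all $t\in I$. Consider the equation \[ u_t+f(t)u_x+g(t)uu_x+h(t)u_{xxt}=0,\qquad (t,x,u)\in I\times\mathbb R\times\mathbb R. \tag{E} \] A point transformation is an injective smooth map $(t,x,u)\mapsto(T(t,x,u),X(t,x,u),U(t,x,u))$ on an open subset of $\mathbb R^3$ (its domain) with $|\partial(T,X,U)/\partial(t,x,u)|\ne0$ everywhere. It maps (E) to an equation (E$'$) of the same form, with coefficients on an open interval $I'$, if its domain lies in $I\times\mathbb R\times\mathbb R$, its image lies in $I'\times\mathbb R\times\mathbb R$, and a third-order jet of a function $u(t,x)$ with values in the domain satisfies (E) if and only if the jet transformed by the prolongation of the map (wherever that is defined) satisfies (E$'$). The following are equivalent: 1. (E) is mapped to an equation of the same form with constant coefficients $\tilde f,\tilde g,\tilde h$, $\tilde g\tilde h\ne0$, on some open interval $I'$, by a point transformation of $I\times\mathbb R\times\mathbb R$ onto $I'\times\mathbb R\times\mathbb R$; 2. for every $t_0\in I$, (E) is mapped to an equation of the same form with constant coefficients by some point transformation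 whose domain contains a point with $t=t_0$; 3. $\left(\dfrac fg\right)_t=0$ and $h_t=0$ on $I$; 4. $h$ is constant on $I$, and $f=c\,g$ on $I$ for some constant $c\in\mathbb R$. -/

import Mathlib

open Set
open scoped ContDiff

namespace BBM

/-- The partial derivative `u_t` of a function of `(t, x)`. -/
noncomputable def dt (u : ℝ × ℝ → ℝ) : ℝ × ℝ → ℝ :=
  fun z => deriv (fun s => u (s, z.2)) z.1

/-- The partial derivative `u_x` of a function of `(t, x)`. -/
noncomputable def dx (u : ℝ × ℝ → ℝ) : ℝ × ℝ → ℝ :=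
  fun z => deriv (fun y => u (z.1, y)) z.2

/-- An equation `u_t + f(t) u_x + g(t) u u_x + h(t) u_xxt = 0`, where `f`, `g`, `h` are smooth
functions on an open interval `I` of values of `t`, with `g h ≠ 0` on `I`. -/
structure Equation where
  I : Set ℝ
  isOpen_I : IsOpen I
  ordConnected_I : I.OrdConnected
  f : ℝ → ℝ
  g : ℝ → ℝ
  h : ℝ → ℝ
  smooth_f : ContDiffOn ℝ ∞ f I
  smooth_g : ContDiffOn ℝ ∞ g I
  smooth_h : ContDiffOn ℝ ∞ h I
  g_ne_zero : ∀ t ∈ I, g t ≠ 0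
  h_ne_zero : ∀ t ∈ I, h t ≠ 0

namespace Equation

/-- The part `I × ℝ × ℝ` of the space of the variables `(t, x, u)` over which the equation is
given. -/
def space (E : Equation) : Set (ℝ × ℝ × ℝ) := {p | p.1 ∈ E.I}

/-- The function `u` satisfies the equation at the point `z = (t, x)`. For `u` smooth near `z`,
this is a condition on the third-order jet of `u` at `z`. -/
def HoldsAt (E : Equation) (u : ℝ × ℝ → ℝ) (z : ℝ × ℝ) : Prop :=
  dt u z + E.f z.1 * dx u z + E.g z.1 * u z * dx u z + E.h z.1 * dt (dx (dx u)) z = 0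

/-- The coefficients `f`, `g`, `h` are constants. -/
def IsConstCoeff (E : Equation) : Prop :=
  ∃ a b c : ℝ, ∀ t ∈ E.I, E.f t = a ∧ E.g t = b ∧ E.h t = c

end Equation

/-- A point transformation
`(t, x, u) ↦ (T(t, x, u), X(t, x, u), U(t, x, u))`: a smooth injective map on an open subset
`dom` of the space of `(t, x, u)`, whose Jacobian vanishes nowhere on `dom`. -/
structure PointTransformation where
  dom : Set (ℝ × ℝ × ℝ)
  isOpen_dom : IsOpen dom
  map : ℝ × ℝ × ℝ → ℝ × ℝ × ℝ
  smooth_map : ContDiffOn ℝ ∞ map dom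
  injOn_map : InjOn map dom
  jacobian_ne_zero : ∀ p ∈ dom, (fderiv ℝ map p).det ≠ 0

namespace PointTransformation

/-- The point `(t, x, u(t, x))` of the graph of `u` over `z = (t, x)`. -/
def graphPt (u : ℝ × ℝ → ℝ) (z : ℝ × ℝ) : ℝ × ℝ × ℝ := (z.1, z.2, u z)

/-- The point `(T, X)` of the new independent variables that corresponds to `z = (t, x)` on the
graph of `u`. -/
def newPt (Φ : PointTransformation) (u : ℝ × ℝ → ℝ) (z : ℝ × ℝ) : ℝ × ℝ :=
  ((Φ.map (graphPt u z)).1, (Φ.map (graphPt u z)).2.1)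

/-- The transformation takes the graph of the smooth function `u`, given on the open set `V`, into
the graph of the smooth function `v`, given on the open set `W`; that is,
`v (T(t, x, u), X(t, x, u)) = U(t, x, u)` for `u = u(t, x)`, `(t, x) ∈ V`. (As the image of
the graph of `u` is an immersed surface, the map `(t, x) ↦ (T, X)` is then a local
diffeomorphism, so that the jets of `v` are the transforms of the jets of `u`.) -/
structure TakesTo (Φ : PointTransformation) (V : Set (ℝ × ℝ)) (u : ℝ × ℝ → ℝ)
    (W : Set (ℝ × ℝ)) (v : ℝ × ℝ → ℝ) : Prop where
  isOpen_source : IsOpen V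
  isOpen_target : IsOpen W
  smooth_source : ContDiffOn ℝ ∞ u V
  smooth_target : ContDiffOn ℝ ∞ v W
  graph_mem : ∀ z ∈ V, graphPt u z ∈ Φ.dom
  newPt_mem : ∀ z ∈ V, Φ.newPt u z ∈ W
  map_graph : ∀ z ∈ V, Φ.map (graphPt u z) = graphPt v (Φ.newPt u z)

/-- The point transformation maps (its part of) the equation `E` to the equation `E'`: a
third-order jet of a function lies on the manifold defined by `E` in the jet space if and only if
the transformed jet lies on the manifold defined by `E'`. The third-order prolongation of the
transformation is expressed through functions that represent the jets. -/
def MapsEquation (Φ : PointTransformation) (E E' : Equation) : Prop :=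
  Φ.dom ⊆ E.space ∧ MapsTo Φ.map Φ.dom E'.space ∧
    ∀ (V : Set (ℝ × ℝ)) (u : ℝ × ℝ → ℝ) (W : Set (ℝ × ℝ)) (v : ℝ × ℝ → ℝ),
      Φ.TakesTo V u W v → ∀ z ∈ V, (E.HoldsAt u z ↔ E'.HoldsAt v (Φ.newPt u z))

end PointTransformation

namespace Equation

/-- `E` is reduced to a constant-coefficient equation of the class by a point transformation of
the whole of `I × ℝ × ℝ` onto the whole space `I' × ℝ × ℝ` of the new equation. -/
def Reducible (E : Equation) : Prop :=
  ∃ (E' : Equation) (Φ : PointTransformation), E'.IsConstCoeff ∧ Φ.MapsEquation E E' ∧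
    Φ.dom = E.space ∧ Φ.map '' Φ.dom = E'.space

/-- `E` is reduced to constant-coefficient equations of the class by local point transformations:
for each `t₀ ∈ I` there is one whose domain, however small, contains a point with `t = t₀`. -/
def LocallyReducible (E : Equation) : Prop :=
  ∀ t₀ ∈ E.I, ∃ (E' : Equation) (Φ : PointTransformation), E'.IsConstCoeff ∧
    Φ.MapsEquation E E' ∧ ∃ x₀ u₀ : ℝ, (t₀, x₀, u₀) ∈ Φ.dom

/-- The condition `(f / g)_t = h_t = 0`. -/
def Criterion (E : Equation) : Prop :=
  ∀ t ∈ E.I, deriv (fun s => E.f s / E.g s) t = 0 ∧ deriv E.h t = 0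

end Equation

end BBM

/-! Sufficiency is explicit. If `h` is constant and `f = c g`, take `T = ∫ g` as the new time and
keep `x` and `u`. Every term of (E) then carries the factor `g`, and division by it leaves `u_T + c
u_X + u u_X + h u_TXX = 0`, on the whole space.

Necessity is proved pointwise over the domain of a transformation, so local and global reducibility
are handled together. There are three stages.

The independent variables do not mix. Take a function satisfying (E) at a point and add a product of
three linear forms whose `txx`-derivative vanishes. Lower-order derivatives are unchanged there and
(E) still holds, so the change produced in the new third-order jet must have zero `TXX`-derivative
(`MapsEquation.third_order`). Thus the total Jacobian matrix of `(T, X)` respects the cubic symbol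
`τξ²`. Testing with `x³`, `t³` and `xt²` makes that matrix diagonal wherever it is invertible, and
varying `u_t` and `u_x` gives `T_x = T_u = X_t = X_u = 0` (`MapsEquation.fiber_preserving`).

Next, (E') is pulled back and `u_txx` is eliminated by (E). What remains is a polynomial identity in
the free derivatives `u_t, u_x, u_xx, u_tx` (`MapsEquation.jet_polynomial`). Its coefficients give
`U_tu = U_uu = 0`, `2 X_x U_xu = X_xx U_u`, and three relations involving the coefficients of the
equations (`MapsEquation.determining_second`, `MapsEquation.determining_first`).

Finally let (E') have constant coefficients `α, β, γ` (`MapsEquation.criterion_at`). One relation is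
`h T_t X_x (α + βU) = γ(f + gu)`. Its derivatives in `u` and `x` force `X_xx = U_x = 0`; the others
then give `U_t = 0` and `h X_x² = γ`, so `h_t = 0`. Dividing the first relation by its
`u`-derivative expresses `f/g` through `U`, `U_u` and `u`, none of which varies with `t`. -/

namespace BBM

/-- The derivative of `F` in the constant direction `v`. -/
noncomputable def pd {E : Type*} [NormedAddCommGroup E] [NormedSpace ℝ E] (v : E) (F : E → ℝ) :
    E → ℝ := fun p => fderiv ℝ F p v

/-! ### Directional derivatives of smooth functions -/

section Calculus

variable {E : Type*} [NormedAddCommGroup E] [NormedSpace ℝ E] {O : Set E} {F G : E → ℝ} {p : E}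

theorem smoothOn_differentiableAt (hO : IsOpen O) (hF : ContDiffOn ℝ ∞ F O) (hp : p ∈ O) :
    DifferentiableAt ℝ F p :=
  (hF.contDiffAt (hO.mem_nhds hp)).differentiableAt (by simp)

theorem pd_smooth (hO : IsOpen O) (hF : ContDiffOn ℝ ∞ F O) (v : E) :
    ContDiffOn ℝ ∞ (pd v F) O :=
  (hF.fderiv_of_isOpen hO (by simp)).clm_apply contDiffOn_const

theorem pd_congr (hO : IsOpen O) (h : EqOn F G O) (v : E) : EqOn (pd v F) (pd v G) O := by
  intro q hq
  have : F =ᶠ[nhds q] G := Filter.eventually_of_mem (hO.mem_nhds hq) h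
  simp only [pd, this.fderiv_eq]

theorem pd_zero_of_eqOn (hO : IsOpen O) (h : ∀ q ∈ O, F q = 0) (v : E) :
    ∀ q ∈ O, pd v F q = 0 := by
  intro q hq
  rw [pd_congr (G := fun _ => (0 : ℝ)) hO h v hq]
  simp [pd]

theorem pd_add (hO : IsOpen O) (hF : ContDiffOn ℝ ∞ F O) (hG : ContDiffOn ℝ ∞ G O) (v : E) :
    EqOn (pd v (fun q => F q + G q)) (fun q => pd v F q + pd v G q) O := by
  intro q hq
  have h1 := smoothOn_differentiableAt hO hF hq
  have h2 := smoothOn_differentiableAt hO hG hq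
  simp only [pd]
  rw [fderiv_fun_add h1 h2]; simp

theorem pd_sub (hO : IsOpen O) (hF : ContDiffOn ℝ ∞ F O) (hG : ContDiffOn ℝ ∞ G O) (v : E) :
    EqOn (pd v (fun q => F q - G q)) (fun q => pd v F q - pd v G q) O := by
  intro q hq
  have h1 := smoothOn_differentiableAt hO hF hq
  have h2 := smoothOn_differentiableAt hO hG hq
  simp only [pd]
  rw [fderiv_fun_sub h1 h2]; simp

theorem pd_mul (hO : IsOpen O) (hF : ContDiffOn ℝ ∞ F O) (hG : ContDiffOn ℝ ∞ G O) (v : E) :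
    EqOn (pd v (fun q => F q * G q)) (fun q => pd v F q * G q + F q * pd v G q) O := by
  intro q hq
  have h1 := smoothOn_differentiableAt hO hF hq
  have h2 := smoothOn_differentiableAt hO hG hq
  simp only [pd]
  rw [fderiv_fun_mul h1 h2]; simp; ring

theorem pd_comm (hO : IsOpen O) (hF : ContDiffOn ℝ ∞ F O) (v w : E) :
    EqOn (pd v (pd w F)) (pd w (pd v F)) O := by
  intro q hq
  have hc := hF.contDiffAt (hO.mem_nhds hq)
  have hd : DifferentiableAt ℝ (fderiv ℝ F) q :=
    ((hF.fderiv_of_isOpen hO (m := ∞) (by simp)).contDiffAt (hO.mem_nhds hq)).differentiableAt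
      (by simp)
  have hs : IsSymmSndFDerivAt ℝ F q := hc.isSymmSndFDerivAt
    (by simpa using WithTop.coe_le_coe.2 (le_top : (2 : ℕ∞) ≤ ⊤))
  have key : ∀ a b : E, pd a (pd b F) q = fderiv ℝ (fderiv ℝ F) q a b := by
    intro a b
    change fderiv ℝ (fun y => fderiv ℝ F y b) q a = _
    rw [fderiv_clm_apply hd (differentiableAt_const b)]
    simp
  rw [key, key]
  exact hs v w

end Calculus

/-! ### Chain rules along graphs, and the equation in terms of directional derivatives -/

section Chain

/-- Partial derivatives of a composition with a map into the plane. -/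
theorem pd_comp_pair {E : Type*} [NormedAddCommGroup E] [NormedSpace ℝ E] {O : Set E}
    {W : Set (ℝ × ℝ)} {v : ℝ × ℝ → ℝ} {A B : E → ℝ} (hO : IsOpen O) (hW : IsOpen W)
    (hv : ContDiffOn ℝ ∞ v W) (hA : ContDiffOn ℝ ∞ A O) (hB : ContDiffOn ℝ ∞ B O)
    (hm : ∀ z ∈ O, (A z, B z) ∈ W) (e : E) :
    EqOn (pd e (fun z => v (A z, B z)))
      (fun z => pd (1, 0) v (A z, B z) * pd e A z + pd (0, 1) v (A z, B z) * pd e B z) O := by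
  intro z hz
  have h1 := (smoothOn_differentiableAt hO hA hz).hasFDerivAt
  have h2 := (smoothOn_differentiableAt hO hB hz).hasFDerivAt
  have h3 := (smoothOn_differentiableAt hW hv (hm z hz)).hasFDerivAt
  have h4 := h3.comp z (h1.prodMk h2)
  have h5 : pd e (fun z => v (A z, B z)) z =
      fderiv ℝ v (A z, B z) (fderiv ℝ A z e, fderiv ℝ B z e) := by
    have : fderiv ℝ (fun z => v (A z, B z)) z = _ := h4.fderiv
    simp only [pd, this]; simp
  rw [h5]
  have h6 : ((fderiv ℝ A z e, fderiv ℝ B z e) : ℝ × ℝ) =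
      (fderiv ℝ A z e) • ((1 : ℝ), (0 : ℝ)) + (fderiv ℝ B z e) • ((0 : ℝ), (1 : ℝ)) := by simp
  rw [h6, map_add, map_smul, map_smul]
  simp only [pd, smul_eq_mul]; ring

variable {O : Set (ℝ × ℝ × ℝ)} {V : Set (ℝ × ℝ)} {F : ℝ × ℝ × ℝ → ℝ} {u : ℝ × ℝ → ℝ}

open PointTransformation (graphPt)

theorem graphPt_smooth (hu : ContDiffOn ℝ ∞ u V) : ContDiffOn ℝ ∞ (graphPt u) V :=
  contDiffOn_fst.prodMk (contDiffOn_snd.prodMk hu)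

theorem comp_graphPt_smooth (hF : ContDiffOn ℝ ∞ F O) (hu : ContDiffOn ℝ ∞ u V)
    (hm : ∀ z ∈ V, graphPt u z ∈ O) : ContDiffOn ℝ ∞ (fun z => F (graphPt u z)) V :=
  hF.comp (graphPt_smooth hu) hm

theorem pd_comp_graphPt (hO : IsOpen O) (hV : IsOpen V) (hF : ContDiffOn ℝ ∞ F O)
    (hu : ContDiffOn ℝ ∞ u V) (hm : ∀ z ∈ V, graphPt u z ∈ O) (e : ℝ × ℝ) :
    EqOn (pd e (fun z => F (graphPt u z)))
      (fun z => pd (e.1, e.2, 0) F (graphPt u z) + pd (0, 0, 1) F (graphPt u z) * pd e u z) V := by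
  intro z hz
  have h2 := (smoothOn_differentiableAt hV hu hz).hasFDerivAt
  have h3 := (smoothOn_differentiableAt hO hF (hm z hz)).hasFDerivAt
  have h4 := h3.comp z ((hasFDerivAt_fst (p := z)).prodMk ((hasFDerivAt_snd (p := z)).prodMk h2))
  have h5 : pd e (fun z => F (graphPt u z)) z =
      fderiv ℝ F (graphPt u z) (e.1, e.2, fderiv ℝ u z e) := by
    have : fderiv ℝ (fun z => F (graphPt u z)) z = _ := h4.fderiv
    simp only [pd, this]; simp
  rw [h5]
  have h6 : ((e.1, e.2, fderiv ℝ u z e) : ℝ × ℝ × ℝ) =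
      (e.1, e.2, 0) + (fderiv ℝ u z e) • ((0 : ℝ), (0 : ℝ), (1 : ℝ)) := by simp
  rw [h6, map_add, map_smul]
  simp only [pd, smul_eq_mul]; ring

/-- The derivatives of a composition with a graph that enter the equation. -/
theorem pd_comp_graphPt_jet (hO : IsOpen O) (hV : IsOpen V) (hF : ContDiffOn ℝ ∞ F O)
    (hu : ContDiffOn ℝ ∞ u V) (hm : ∀ z ∈ V, graphPt u z ∈ O) {z : ℝ × ℝ} (hz : z ∈ V) :
    pd (1, 0) (pd (0, 1) (fun z => F (graphPt u z))) z =
      (pd (1, 0, 0) (pd (0, 1, 0) F) (graphPt u z)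
        + pd (0, 0, 1) (pd (0, 1, 0) F) (graphPt u z) * pd (1, 0) u z)
      + (pd (1, 0, 0) (pd (0, 0, 1) F) (graphPt u z)
        + pd (0, 0, 1) (pd (0, 0, 1) F) (graphPt u z) * pd (1, 0) u z) * pd (0, 1) u z
      + pd (0, 0, 1) F (graphPt u z) * pd (1, 0) (pd (0, 1) u) z ∧
    pd (1, 0) (pd (0, 1) (pd (0, 1) (fun z => F (graphPt u z)))) z =
      (pd (1, 0, 0) (pd (0, 1, 0) (pd (0, 1, 0) F)) (graphPt u z)
        + pd (0, 0, 1) (pd (0, 1, 0) (pd (0, 1, 0) F)) (graphPt u z) * pd (1, 0) u z)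
      + ((pd (1, 0, 0) (pd (0, 0, 1) (pd (0, 1, 0) F)) (graphPt u z)
          + pd (0, 0, 1) (pd (0, 0, 1) (pd (0, 1, 0) F)) (graphPt u z) * pd (1, 0) u z)
            * pd (0, 1) u z
        + pd (0, 0, 1) (pd (0, 1, 0) F) (graphPt u z) * pd (1, 0) (pd (0, 1) u) z)
      + ((pd (1, 0, 0) (pd (0, 1, 0) (pd (0, 0, 1) F)) (graphPt u z)
          + pd (0, 0, 1) (pd (0, 1, 0) (pd (0, 0, 1) F)) (graphPt u z) * pd (1, 0) u z
          + ((pd (1, 0, 0) (pd (0, 0, 1) (pd (0, 0, 1) F)) (graphPt u z)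
            + pd (0, 0, 1) (pd (0, 0, 1) (pd (0, 0, 1) F)) (graphPt u z) * pd (1, 0) u z)
              * pd (0, 1) u z
            + pd (0, 0, 1) (pd (0, 0, 1) F) (graphPt u z) * pd (1, 0) (pd (0, 1) u) z))
          * pd (0, 1) u z
        + (pd (0, 1, 0) (pd (0, 0, 1) F) (graphPt u z)
          + pd (0, 0, 1) (pd (0, 0, 1) F) (graphPt u z) * pd (0, 1) u z)
            * pd (1, 0) (pd (0, 1) u) z)
      + ((pd (1, 0, 0) (pd (0, 0, 1) F) (graphPt u z)
          + pd (0, 0, 1) (pd (0, 0, 1) F) (graphPt u z) * pd (1, 0) u z)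
            * pd (0, 1) (pd (0, 1) u) z
        + pd (0, 0, 1) F (graphPt u z) * pd (1, 0) (pd (0, 1) (pd (0, 1) u)) z) := by
  have sF : ∀ {H : ℝ × ℝ × ℝ → ℝ} (e), ContDiffOn ℝ ∞ H O → ContDiffOn ℝ ∞ (pd e H) O :=
    fun e h => pd_smooth hO h e
  have su : ∀ {w : ℝ × ℝ → ℝ} (e), ContDiffOn ℝ ∞ w V → ContDiffOn ℝ ∞ (pd e w) V :=
    fun e h => pd_smooth hV h e
  have sg : ∀ {H : ℝ × ℝ × ℝ → ℝ}, ContDiffOn ℝ ∞ H O →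
      ContDiffOn ℝ ∞ (fun z => H (graphPt u z)) V := fun h => comp_graphPt_smooth h hu hm
  have ch : ∀ {H : ℝ × ℝ × ℝ → ℝ} (e : ℝ × ℝ), ContDiffOn ℝ ∞ H O → EqOn _ _ V :=
    fun {H} e h => pd_comp_graphPt (F := H) hO hV h hu hm e
  set F2 := pd (0, 1, 0) F with hF2
  set F3 := pd (0, 0, 1) F with hF3
  have s2 : ContDiffOn ℝ ∞ F2 O := sF _ hF
  have s3 : ContDiffOn ℝ ∞ F3 O := sF _ hF
  have sx := su (0, 1) hu
  have sxx := su (0, 1) sx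
  have N1 : EqOn (pd (0, 1) (fun z => F (graphPt u z)))
      (fun z => F2 (graphPt u z) + F3 (graphPt u z) * pd (0, 1) u z) V := ch (0, 1) hF
  have D : ∀ e : ℝ × ℝ, EqOn (pd e (fun z => F2 (graphPt u z) + F3 (graphPt u z) * pd (0, 1) u z))
      (fun z => (pd (e.1, e.2, 0) F2 (graphPt u z) + pd (0, 0, 1) F2 (graphPt u z) * pd e u z)
        + ((pd (e.1, e.2, 0) F3 (graphPt u z) + pd (0, 0, 1) F3 (graphPt u z) * pd e u z)
          * pd (0, 1) u z + F3 (graphPt u z) * pd e (pd (0, 1) u) z)) V := by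
    intro e z hz
    rw [pd_add hV (sg s2) ((sg s3).mul sx) e hz]
    simp only
    rw [ch e s2 hz, pd_mul hV (sg s3) sx e hz]
    simp only
    rw [ch e s3 hz]
  have N2 := (pd_congr hV N1 (0, 1)).trans (D (0, 1))
  refine ⟨?_, ?_⟩
  · rw [pd_congr hV N1 (1, 0) hz, D (1, 0) hz]; ring
  · rw [pd_congr hV N2 (1, 0) hz]
    have s22 := sF (0, 1, 0) s2
    have s32 := sF (0, 0, 1) s2
    have s23 := sF (0, 1, 0) s3
    have s33 := sF (0, 0, 1) s3
    have m1 : ContDiffOn ℝ ∞ (fun z => pd (0, 0, 1) F2 (graphPt u z) * pd (0, 1) u z) V :=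
      (sg s32).mul sx
    have m2 : ContDiffOn ℝ ∞ (fun z => pd (0, 0, 1) F3 (graphPt u z) * pd (0, 1) u z) V :=
      (sg s33).mul sx
    have m3 : ContDiffOn ℝ ∞ (fun z => pd (0, 1, 0) F3 (graphPt u z)
      + pd (0, 0, 1) F3 (graphPt u z) * pd (0, 1) u z) V := (sg s23).add m2
    have m4 := m3.mul sx
    have m5 : ContDiffOn ℝ ∞ (fun z => F3 (graphPt u z) * pd (0, 1) (pd (0, 1) u) z) V :=
      (sg s3).mul sxx
    have m6 := (sg s22).add m1
    rw [pd_add hV m6 (m4.add m5) _ hz]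
    simp only
    rw [pd_add hV (sg s22) m1 _ hz, pd_add hV m4 m5 _ hz]
    simp only
    rw [pd_mul hV (sg s32) sx _ hz, pd_mul hV m3 sx _ hz, pd_mul hV (sg s3) sxx _ hz]
    simp only
    rw [pd_add hV (sg s23) m2 _ hz]
    simp only
    rw [pd_mul hV (sg s33) sx _ hz]
    simp only
    rw [ch _ s22 hz, ch _ s32 hz, ch _ s23 hz, ch _ s33 hz, ch _ s3 hz]
    ring

/-- A product of three functions that vanish at a point. -/
theorem pd_prod_three {A B C : ℝ × ℝ → ℝ} (hV : IsOpen V) (hA : ContDiffOn ℝ ∞ A V)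
    (hB : ContDiffOn ℝ ∞ B V) (hC : ContDiffOn ℝ ∞ C V) {z : ℝ × ℝ} (hz : z ∈ V)
    (a0 : A z = 0) (b0 : B z = 0) (c0 : C z = 0) (e f d : ℝ × ℝ) :
    pd e (fun z => A z * B z * C z) z = 0 ∧
    pd e (pd f (fun z => A z * B z * C z)) z = 0 ∧
    pd e (pd f (pd d (fun z => A z * B z * C z))) z =
      pd d A z * (pd f B z * pd e C z + pd e B z * pd f C z)
      + pd f A z * (pd d B z * pd e C z + pd e B z * pd d C z)
      + pd e A z * (pd d B z * pd f C z + pd f B z * pd d C z) := by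
  have s : ∀ {w : ℝ × ℝ → ℝ} (e), ContDiffOn ℝ ∞ w V → ContDiffOn ℝ ∞ (pd e w) V :=
    fun e h => pd_smooth hV h e
  have P : ∀ {A B C : ℝ × ℝ → ℝ}, ContDiffOn ℝ ∞ A V → ContDiffOn ℝ ∞ B V → ContDiffOn ℝ ∞ C V →
      ∀ e, EqOn (pd e (fun z => A z * B z * C z)) (fun z => pd e A z * B z * C z
        + A z * pd e B z * C z + A z * B z * pd e C z) V := by
    intro A B C hA hB hC e z hz
    rw [pd_mul hV (hA.mul hB) hC e hz]
    simp only
    rw [pd_mul hV hA hB e hz]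
    ring
  have S : ∀ {A B C : ℝ × ℝ → ℝ}, ContDiffOn ℝ ∞ A V → ContDiffOn ℝ ∞ B V → ContDiffOn ℝ ∞ C V →
      ContDiffOn ℝ ∞ (fun z => A z * B z * C z) V := fun h1 h2 h3 => (h1.mul h2).mul h3
  have Q : ∀ {A B C : ℝ × ℝ → ℝ}, ContDiffOn ℝ ∞ A V → ContDiffOn ℝ ∞ B V → ContDiffOn ℝ ∞ C V →
      ∀ e f, EqOn (pd e (pd f (fun z => A z * B z * C z)))
        (fun z => pd e (fun z => pd f A z * B z * C z) z
        + pd e (fun z => A z * pd f B z * C z) z + pd e (fun z => A z * B z * pd f C z) z) V := by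
    intro A B C hA hB hC e f z hz
    rw [pd_congr hV (P hA hB hC f) e hz, pd_add hV ((S (s f hA) hB hC).add (S hA (s f hB) hC))
      (S hA hB (s f hC)) e hz]
    simp only
    rw [pd_add hV (S (s f hA) hB hC) (S hA (s f hB) hC) e hz]
  refine ⟨?_, ?_, ?_⟩
  · rw [P hA hB hC e hz]; simp [a0, b0, c0]
  · rw [Q hA hB hC e f hz]; simp only
    rw [P (s f hA) hB hC e hz, P hA (s f hB) hC e hz, P hA hB (s f hC) e hz]
    simp [a0, b0, c0]
  · have s1 := S (s d hA) hB hC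
    have s2 := S hA (s d hB) hC
    have s3 := S hA hB (s d hC)
    have h := Q hA hB hC f d
    rw [pd_congr hV h e hz, pd_add hV ((s f s1).add (s f s2)) (s f s3) e hz]
    simp only
    rw [pd_add hV (s f s1) (s f s2) e hz]
    simp only
    rw [Q (s d hA) hB hC e f hz, Q hA (s d hB) hC e f hz, Q hA hB (s d hC) e f hz]
    simp only
    rw [P (s f (s d hA)) hB hC e hz, P (s d hA) (s f hB) hC e hz, P (s d hA) hB (s f hC) e hz,
      P (s f hA) (s d hB) hC e hz, P hA (s f (s d hB)) hC e hz, P hA (s d hB) (s f hC) e hz,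
      P (s f hA) hB (s d hC) e hz, P hA (s f hB) (s d hC) e hz, P hA hB (s f (s d hC)) e hz]
    -- Only the terms in which each factor is differentiated exactly once survive at the common
    -- zero.
    simp only [a0, b0, c0]
    ring

theorem dt_eq_pd (hV : IsOpen V) (hu : ContDiffOn ℝ ∞ u V) : EqOn (dt u) (pd (1, 0) u) V := by
  intro z hz
  have h := (smoothOn_differentiableAt hV hu hz).hasFDerivAt
  have h1 : HasDerivAt (fun s : ℝ => (s, z.2)) ((1 : ℝ), (0 : ℝ)) z.1 :=
    (hasDerivAt_id z.1).prodMk (hasDerivAt_const z.1 z.2)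
  exact (h.comp_hasDerivAt (f := fun s : ℝ => (s, z.2)) z.1 h1).deriv

theorem dx_eq_pd (hV : IsOpen V) (hu : ContDiffOn ℝ ∞ u V) : EqOn (dx u) (pd (0, 1) u) V := by
  intro z hz
  have h := (smoothOn_differentiableAt hV hu hz).hasFDerivAt
  have h1 : HasDerivAt (fun s : ℝ => (z.1, s)) ((0 : ℝ), (1 : ℝ)) z.2 :=
    (hasDerivAt_const z.2 z.1).prodMk (hasDerivAt_id z.2)
  exact (h.comp_hasDerivAt (f := fun s : ℝ => (z.1, s)) z.2 h1).deriv

/-- Smoothness on an open set turns the iterated one-variable derivatives of `HoldsAt` into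
directional derivatives, to which the chain rules above apply. -/
theorem holdsAt_iff_pd (E : Equation) (hV : IsOpen V) (hu : ContDiffOn ℝ ∞ u V) {z : ℝ × ℝ}
    (hz : z ∈ V) : E.HoldsAt u z ↔ pd (1, 0) u z + E.f z.1 * pd (0, 1) u z
      + E.g z.1 * u z * pd (0, 1) u z
      + E.h z.1 * pd (1, 0) (pd (0, 1) (pd (0, 1) u)) z = 0 := by
  have s1 := pd_smooth hV hu (0, 1)
  have s2 := pd_smooth hV s1 (0, 1)
  have h1 := dx_eq_pd hV hu
  have c1 : ContDiffOn ℝ ∞ (dx u) V := s1.congr h1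
  have h2 : EqOn (dx (dx u)) (pd (0, 1) (pd (0, 1) u)) V :=
    (dx_eq_pd hV c1).trans (pd_congr hV h1 _)
  have c2 : ContDiffOn ℝ ∞ (dx (dx u)) V := s2.congr h2
  have h3 : EqOn (dt (dx (dx u))) (pd (1, 0) (pd (0, 1) (pd (0, 1) u))) V :=
    (dt_eq_pd hV c2).trans (pd_congr hV h2 _)
  rw [Equation.HoldsAt, dt_eq_pd hV hu hz, h1 hz, h3 hz]

end Chain

/-! ### Local inverses and images of graphs -/

theorem exists_local_inverse {φ : ℝ × ℝ → ℝ × ℝ} {V₀ : Set (ℝ × ℝ)} (hV₀ : IsOpen V₀)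
    (hφ : ContDiffOn ℝ ∞ φ V₀) {z : ℝ × ℝ} (hz : z ∈ V₀)
    (hinj : ∀ e, fderiv ℝ φ z e = 0 → e = 0) :
    ∃ (V W : Set (ℝ × ℝ)) (ψ : ℝ × ℝ → ℝ × ℝ), IsOpen V ∧ IsOpen W ∧ V ⊆ V₀ ∧ z ∈ V ∧
      ContDiffOn ℝ ∞ ψ W ∧ MapsTo φ V W ∧ (∀ y ∈ W, ψ y ∈ V ∧ φ (ψ y) = y) ∧
      ∀ y ∈ V, ψ (φ y) = y := by
  have hinj' : Function.Injective (fderiv ℝ φ z : ℝ × ℝ →ₗ[ℝ] ℝ × ℝ) := by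
    rw [← LinearMap.ker_eq_bot, LinearMap.ker_eq_bot']
    exact fun e he => hinj e he
  let L : (ℝ × ℝ) ≃L[ℝ] (ℝ × ℝ) :=
    (LinearEquiv.ofInjectiveEndo _ hinj').toContinuousLinearEquiv
  have hL : (L : ℝ × ℝ →L[ℝ] ℝ × ℝ) = fderiv ℝ φ z := by
    ext <;> rfl
  have hc : ContinuousOn (fderiv ℝ φ) V₀ := hφ.continuousOn_fderiv_of_isOpen hV₀ (by simp)
  -- The source is cut down to the points where the derivative of `φ` is invertible: the inverse is
  -- then smooth on the whole target and not only at the image of `z`.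
  set R := range ((↑) : ((ℝ × ℝ) ≃L[ℝ] (ℝ × ℝ)) → (ℝ × ℝ) →L[ℝ] (ℝ × ℝ)) with hR
  have hV₁ : IsOpen (V₀ ∩ fderiv ℝ φ ⁻¹' R) :=
    hc.isOpen_inter_preimage hV₀ ContinuousLinearEquiv.isOpen
  have hz₁ : z ∈ V₀ ∩ fderiv ℝ φ ⁻¹' R := ⟨hz, L, hL⟩
  have hat := hφ.contDiffAt (hV₀.mem_nhds hz)
  have hd : HasFDerivAt φ (L : ℝ × ℝ →L[ℝ] ℝ × ℝ) z := by
    rw [hL]; exact (hat.differentiableAt (by simp)).hasFDerivAt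
  let H₀ := hat.toOpenPartialHomeomorph φ hd (by simp)
  have H₀c : (H₀ : ℝ × ℝ → ℝ × ℝ) = φ := hat.toOpenPartialHomeomorph_coe hd (by simp)
  have hzs : z ∈ H₀.source := hat.mem_toOpenPartialHomeomorph_source hd (by simp)
  let H := H₀.restrOpen _ hV₁
  have Hc : (H : ℝ × ℝ → ℝ × ℝ) = φ := H₀c
  have Hs : H.source = H₀.source ∩ (V₀ ∩ fderiv ℝ φ ⁻¹' R) := H₀.restrOpen_source _ hV₁
  refine ⟨H.source, H.target, H.symm, H.open_source, H.open_target, ?_, ?_, ?_, ?_, ?_, ?_⟩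
  · rw [Hs]; exact fun y hy => hy.2.1
  · rw [Hs]; exact ⟨hzs, hz₁⟩
  · intro y hy
    have hy' := H.map_target hy
    rw [Hs] at hy'
    obtain ⟨M, hM⟩ := hy'.2.2
    have hyat := hφ.contDiffAt (hV₀.mem_nhds hy'.2.1)
    refine (H.contDiffAt_symm (f₀' := M) hy ?_ ?_).contDiffWithinAt
    · rw [Hc, hM]; exact (hyat.differentiableAt (by simp)).hasFDerivAt
    · rw [Hc]; exact hyat
  · intro y hy; rw [← Hc]; exact H.map_source hy
  · intro y hy; refine ⟨H.map_target hy, ?_⟩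
    rw [← Hc]; exact H.right_inv hy
  · intro y hy; rw [← Hc]; exact H.left_inv hy

namespace PointTransformation

variable (Φ : PointTransformation)

theorem smooth_T : ContDiffOn ℝ ∞ (fun p => (Φ.map p).1) Φ.dom := Φ.smooth_map.fst
theorem smooth_X : ContDiffOn ℝ ∞ (fun p => (Φ.map p).2.1) Φ.dom := Φ.smooth_map.snd.fst
theorem smooth_U : ContDiffOn ℝ ∞ (fun p => (Φ.map p).2.2) Φ.dom := Φ.smooth_map.snd.snd

theorem fderiv_map_apply {p : ℝ × ℝ × ℝ} (hp : p ∈ Φ.dom) (e : ℝ × ℝ × ℝ) :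
    fderiv ℝ Φ.map p e = (pd e (fun p => (Φ.map p).1) p, pd e (fun p => (Φ.map p).2.1) p,
      pd e (fun p => (Φ.map p).2.2) p) := by
  have h : HasFDerivAt Φ.map (fderiv ℝ Φ.map p) p :=
    ((Φ.smooth_map.contDiffAt (Φ.isOpen_dom.mem_nhds hp)).differentiableAt (by simp)).hasFDerivAt
  have h1 : fderiv ℝ (fun p => (Φ.map p).1) p = _ := h.fst.fderiv
  have h2 : fderiv ℝ (fun p => (Φ.map p).2.1) p = _ := h.snd.fst.fderiv
  have h3 : fderiv ℝ (fun p => (Φ.map p).2.2) p = _ := h.snd.snd.fderiv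
  simp only [pd, h1, h2, h3]
  rfl

/-- A nonzero Jacobian makes the differential surjective. Used to find directions that move only one
of `T`, `X`, `U`. -/
theorem exists_pd_eq {p : ℝ × ℝ × ℝ} (hp : p ∈ Φ.dom) (y : ℝ × ℝ × ℝ) :
    ∃ e : ℝ × ℝ × ℝ, pd e (fun p => (Φ.map p).1) p = y.1 ∧
      pd e (fun p => (Φ.map p).2.1) p = y.2.1 ∧ pd e (fun p => (Φ.map p).2.2) p = y.2.2 := by
  have hd := Φ.jacobian_ne_zero p hp
  obtain ⟨e, he⟩ := (LinearMap.equivOfDetNeZero _ hd).surjective y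
  have he' : fderiv ℝ Φ.map p e = y := he
  rw [Φ.fderiv_map_apply hp] at he'
  exact ⟨e, by rw [← he'], by rw [← he'], by rw [← he']⟩

/-- Where the total Jacobian of `(T, X)` along the graph of `u` is nonzero, `(t, x) ↦ (T, X)` has a
local inverse `ψ`, and the image of the graph is the graph of `U` composed with `ψ`. This supplies
the pairs `u`, `v` on which `MapsEquation` is tested. -/
theorem exists_takesTo {u : ℝ × ℝ → ℝ} (hu : ContDiff ℝ ∞ u) {z : ℝ × ℝ}
    (hz : graphPt u z ∈ Φ.dom)
    (hJ : pd (1, 0) (fun z => (Φ.newPt u z).1) z * pd (0, 1) (fun z => (Φ.newPt u z).2) z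
      - pd (0, 1) (fun z => (Φ.newPt u z).1) z * pd (1, 0) (fun z => (Φ.newPt u z).2) z ≠ 0) :
    ∃ (V W : Set (ℝ × ℝ)) (v : ℝ × ℝ → ℝ) (ψ : ℝ × ℝ → ℝ × ℝ), z ∈ V ∧ Φ.TakesTo V u W v ∧
      ContDiffOn ℝ ∞ ψ W ∧ (∀ y ∈ W, ψ y ∈ V ∧ Φ.newPt u (ψ y) = y) ∧
      ∀ y ∈ V, ψ (Φ.newPt u y) = y := by
  have hg : ContDiff ℝ ∞ (graphPt u) := contDiff_fst.prodMk (contDiff_snd.prodMk hu)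
  have hV₀ : IsOpen (graphPt u ⁻¹' Φ.dom) := Φ.isOpen_dom.preimage hg.continuous
  have hs1 : ContDiffOn ℝ ∞ (fun z => (Φ.newPt u z).1) (graphPt u ⁻¹' Φ.dom) :=
    comp_graphPt_smooth Φ.smooth_T hu.contDiffOn fun _ h => h
  have hs2 : ContDiffOn ℝ ∞ (fun z => (Φ.newPt u z).2) (graphPt u ⁻¹' Φ.dom) :=
    comp_graphPt_smooth Φ.smooth_X hu.contDiffOn fun _ h => h
  have hφ : ContDiffOn ℝ ∞ (Φ.newPt u) (graphPt u ⁻¹' Φ.dom) := hs1.prodMk hs2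
  obtain ⟨V, W, ψ, hV, hW, hVV, hzV, hψ, hm, hr, hl⟩ := exists_local_inverse hV₀ hφ hz (by
    intro e he
    have h1 := (smoothOn_differentiableAt hV₀ hs1 hz).hasFDerivAt
    have h2 := (smoothOn_differentiableAt hV₀ hs2 hz).hasFDerivAt
    have h3 : fderiv ℝ (Φ.newPt u) z = _ := (h1.prodMk h2).fderiv
    rw [h3] at he
    have he1 : fderiv ℝ (fun z => (Φ.newPt u z).1) z e = 0 := congrArg Prod.fst he
    have he2 : fderiv ℝ (fun z => (Φ.newPt u z).2) z e = 0 := congrArg Prod.snd he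
    have hsplit : e = e.1 • ((1 : ℝ), (0 : ℝ)) + e.2 • ((0 : ℝ), (1 : ℝ)) := by simp
    rw [hsplit, map_add, map_smul, map_smul] at he1 he2
    simp only [smul_eq_mul] at he1 he2
    simp only [pd] at hJ
    refine Prod.ext ?_ ?_
    · refine (mul_eq_zero.1 (?_ : e.1 * _ = 0)).resolve_right hJ
      linear_combination fderiv ℝ (fun z => (Φ.newPt u z).2) z (0, 1) * he1
        - fderiv ℝ (fun z => (Φ.newPt u z).1) z (0, 1) * he2
    · refine (mul_eq_zero.1 (?_ : e.2 * _ = 0)).resolve_right hJ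
      linear_combination fderiv ℝ (fun z => (Φ.newPt u z).1) z (1, 0) * he2
        - fderiv ℝ (fun z => (Φ.newPt u z).2) z (1, 0) * he1)
  refine ⟨V, W, fun y => (Φ.map (graphPt u (ψ y))).2.2, ψ, hzV, ?_, hψ, hr, hl⟩
  refine ⟨hV, hW, hu.contDiffOn, ?_, fun y hy => hVV hy, hm, ?_⟩
  · exact Φ.smooth_U.comp (hg.comp_contDiffOn hψ) fun y hy => hVV (hr y hy).1
  · intro y hy
    simp only [graphPt]
    rw [hl y hy]
    rfl

end PointTransformation

/-! ### Test functions: prescribed jets and their third-order perturbations -/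

/-- A polynomial with a prescribed jet at a point. -/
noncomputable def jetPoly (t₁ x₁ c a b p q r : ℝ) : ℝ × ℝ → ℝ := fun z =>
  c + a * (z.1 - t₁) + b * (z.2 - x₁) + p / 2 * (z.2 - x₁) ^ 2 + q * (z.1 - t₁) * (z.2 - x₁)
    + r / 2 * (z.1 - t₁) * (z.2 - x₁) ^ 2

section JetPoly

variable (t₁ x₁ c a b p q r : ℝ)

theorem jetPoly_smooth : ContDiff ℝ ∞ (jetPoly t₁ x₁ c a b p q r) := by
  unfold jetPoly; fun_prop

theorem pd_x_jetPoly : pd (0, 1) (jetPoly t₁ x₁ c a b p q r) =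
    fun z => b + p * (z.2 - x₁) + q * (z.1 - t₁) + r * (z.1 - t₁) * (z.2 - x₁) := by
  funext z
  rw [← dx_eq_pd isOpen_univ (jetPoly_smooth ..).contDiffOn (mem_univ z)]
  have h : HasDerivAt (fun y : ℝ => y - x₁) 1 z.2 := (hasDerivAt_id z.2).sub_const _
  refine HasDerivAt.deriv (f := fun y => jetPoly t₁ x₁ c a b p q r (z.1, y)) ?_
  have h' := (((((h.const_mul b).const_add (c + a * (z.1 - t₁)))).add
    ((h.pow 2).const_mul (p / 2))).add (h.const_mul (q * (z.1 - t₁)))).add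
      ((h.pow 2).const_mul (r / 2 * (z.1 - t₁)))
  exact h'.congr_deriv (by norm_num; ring)

theorem pd_jetPoly : jetPoly t₁ x₁ c a b p q r (t₁, x₁) = c ∧
    pd (1, 0) (jetPoly t₁ x₁ c a b p q r) (t₁, x₁) = a ∧
    pd (0, 1) (jetPoly t₁ x₁ c a b p q r) (t₁, x₁) = b ∧
    pd (1, 0) (pd (0, 1) (jetPoly t₁ x₁ c a b p q r)) (t₁, x₁) = q ∧
    pd (0, 1) (pd (0, 1) (jetPoly t₁ x₁ c a b p q r)) (t₁, x₁) = p ∧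
    pd (1, 0) (pd (0, 1) (pd (0, 1) (jetPoly t₁ x₁ c a b p q r))) (t₁, x₁) = r := by
  have hsw : ∀ {w : ℝ × ℝ → ℝ}, ContDiff ℝ ∞ w → pd (1, 0) w (t₁, x₁) =
      deriv (fun s => w (s, x₁)) t₁ := fun hw =>
    (dt_eq_pd isOpen_univ hw.contDiffOn (mem_univ (t₁, x₁))).symm
  have hxx : pd (0, 1) (fun z : ℝ × ℝ =>
      b + p * (z.2 - x₁) + q * (z.1 - t₁) + r * (z.1 - t₁) * (z.2 - x₁)) =
      fun z => p + r * (z.1 - t₁) := by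
    have : (fun z : ℝ × ℝ => b + p * (z.2 - x₁) + q * (z.1 - t₁) + r * (z.1 - t₁) * (z.2 - x₁)) =
        jetPoly t₁ x₁ b q p 0 r 0 := by funext z; simp only [jetPoly]; ring
    rw [this, pd_x_jetPoly]; funext z; ring
  refine ⟨by simp [jetPoly], ?_, by simp [pd_x_jetPoly], ?_, ?_, ?_⟩
  · rw [hsw (jetPoly_smooth ..)]
    simp [jetPoly]
  · rw [pd_x_jetPoly, hsw (by fun_prop)]
    simp
  · rw [pd_x_jetPoly, hxx]; simp
  · rw [pd_x_jetPoly, hxx, hsw (by fun_prop)]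
    simp

end JetPoly

open PointTransformation (graphPt)

/-- A composition with a graph that is tangent to second order to the graph of zero. -/
theorem pd_comp_graphPt_of_flat {O : Set (ℝ × ℝ × ℝ)} {V : Set (ℝ × ℝ)} {F : ℝ × ℝ × ℝ → ℝ}
    {s : ℝ × ℝ → ℝ} (hO : IsOpen O) (hV : IsOpen V) (hF : ContDiffOn ℝ ∞ F O)
    (hs : ContDiffOn ℝ ∞ s V) (hm : ∀ z ∈ V, graphPt s z ∈ O)
    (hm0 : ∀ z ∈ V, graphPt (fun _ => 0) z ∈ O) (hF0 : ∀ z ∈ V, F (graphPt (fun _ => 0) z) = 0)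
    {z : ℝ × ℝ} (hz : z ∈ V) (s0 : s z = 0) (s1 : ∀ e, pd e s z = 0)
    (s2 : ∀ e f, pd e (pd f s) z = 0) :
    F (graphPt s z) = 0 ∧ (∀ e, pd e (fun y => F (graphPt s y)) z = 0) ∧
    pd (1, 0) (pd (0, 1) (pd (0, 1) (fun y => F (graphPt s y)))) z =
      pd (0, 0, 1) F (graphPt (fun _ => 0) z) * pd (1, 0) (pd (0, 1) (pd (0, 1) s)) z := by
  -- The chain rule is applied to `s` and to the zero function. The latter shows that the
  -- derivatives of `F` along the base vanish, so for `s` only the term with the derivative of `F`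
  -- along the fibre is left.
  have hc : ContDiffOn ℝ ∞ (fun _ : ℝ × ℝ => (0 : ℝ)) V := contDiffOn_const
  have hg : graphPt s z = graphPt (fun _ => 0) z := by simp [graphPt, s0]
  have z1 := fun e => pd_zero_of_eqOn hV hF0 e
  have z2 := fun e f => pd_zero_of_eqOn hV (z1 e) f
  have z3 := pd_zero_of_eqOn hV (z2 (0, 1) (0, 1)) (1, 0) z hz
  have c1 : ∀ e, ∀ y ∈ V, pd e (fun _ : ℝ × ℝ => (0 : ℝ)) y = 0 := fun e y _ => by simp [pd]
  have c2 := fun e f => pd_zero_of_eqOn hV (c1 e) f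
  have c3 := pd_zero_of_eqOn hV (c2 (0, 1) (0, 1)) (1, 0) z hz
  refine ⟨by rw [hg]; exact hF0 z hz, ?_, ?_⟩
  · intro e
    have h1 := pd_comp_graphPt hO hV hF hs hm e hz
    have h0 := pd_comp_graphPt hO hV hF hc hm0 e hz
    rw [z1 e z hz] at h0
    simp only [c1 e z hz, mul_zero, add_zero] at h0
    simp only [s1, hg, ← h0, mul_zero, add_zero] at h1
    exact h1
  · have h1 := (pd_comp_graphPt_jet hO hV hF hs hm hz).2
    have h0 := (pd_comp_graphPt_jet hO hV hF hc hm0 hz).2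
    rw [z3] at h0
    simp only [c1 _ z hz, c2 _ _ z hz, c3, mul_zero, add_zero] at h0
    simp only [s1, s2, hg, ← h0, mul_zero, add_zero, zero_add] at h1
    exact h1

/-- A linear function of `(t, x)`, centred at a point. -/
noncomputable def lin (z₀ : ℝ × ℝ) (m : ℝ × ℝ) : ℝ × ℝ → ℝ := fun z =>
  m.1 * (z.1 - z₀.1) + m.2 * (z.2 - z₀.2)

theorem lin_smooth (z₀ m : ℝ × ℝ) : ContDiff ℝ ∞ (lin z₀ m) := by unfold lin; fun_prop

theorem lin_self (z₀ m : ℝ × ℝ) : lin z₀ m z₀ = 0 := by simp [lin]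

theorem pd_lin (z₀ m e z : ℝ × ℝ) : pd e (lin z₀ m) z = m.1 * e.1 + m.2 * e.2 := by
  have h1 : HasFDerivAt (fun z : ℝ × ℝ => z.1 - z₀.1) (ContinuousLinearMap.fst ℝ ℝ ℝ) z :=
    hasFDerivAt_fst.sub_const _
  have h2 : HasFDerivAt (fun z : ℝ × ℝ => z.2 - z₀.2) (ContinuousLinearMap.snd ℝ ℝ ℝ) z :=
    hasFDerivAt_snd.sub_const _
  have h : fderiv ℝ (lin z₀ m) z = _ := ((h1.const_mul m.1).add (h2.const_mul m.2)).fderiv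
  simp [pd, h]

theorem pd_snd (e z : ℝ × ℝ) : pd e (fun y : ℝ × ℝ => y.2) z = e.2 := by
  have h : fderiv ℝ (fun y : ℝ × ℝ => y.2) z = _ := hasFDerivAt_snd.fderiv
  simp [pd, h]

theorem pd_fst (e z : ℝ × ℝ) : pd e (fun y : ℝ × ℝ => y.1) z = e.1 := by
  have h : fderiv ℝ (fun y : ℝ × ℝ => y.1) z = _ := hasFDerivAt_fst.fderiv
  simp [pd, h]

/-- A solution at a point with prescribed first-order jet, perturbed by a product of three linear
functions. -/
theorem perturbed_jet {E : Equation} {z : ℝ × ℝ} (c a b : ℝ) (hh : E.h z.1 ≠ 0)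
    {m n k : ℝ × ℝ} (hmnk : m.2 * n.2 * k.1 + m.2 * n.1 * k.2 + m.1 * n.2 * k.2 = 0) :
    ∃ u₀ : ℝ × ℝ → ℝ, ContDiff ℝ ∞ u₀ ∧ (u₀ z = c ∧ pd (1, 0) u₀ z = a ∧ pd (0, 1) u₀ z = b ∧
      E.HoldsAt u₀ z) ∧
      ContDiff ℝ ∞ (fun y => u₀ y + lin z m y * lin z n y * lin z k y) ∧
      (pd (1, 0) (fun y => u₀ y + lin z m y * lin z n y * lin z k y) z = a ∧
       pd (0, 1) (fun y => u₀ y + lin z m y * lin z n y * lin z k y) z = b ∧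
        E.HoldsAt (fun y => u₀ y + lin z m y * lin z n y * lin z k y) z) := by
  -- The value of `u_txx` that the equation dictates.
  set r := -(a + (E.f z.1 + E.g z.1 * c) * b) / E.h z.1 with hr
  have hrh : E.h z.1 * r = -(a + (E.f z.1 + E.g z.1 * c) * b) := by rw [hr]; field_simp
  obtain ⟨j0, j1, j2, -, -, j3⟩ := pd_jetPoly z.1 z.2 c a b 0 0 r
  have hs := jetPoly_smooth z.1 z.2 c a b 0 0 r
  set u₀ := jetPoly z.1 z.2 c a b 0 0 r with hu₀
  have sm := fun m => lin_smooth z m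
  have hw : ContDiff ℝ ∞ (fun y => lin z m y * lin z n y * lin z k y) :=
    ((sm m).mul (sm n)).mul (sm k)
  have hP := pd_prod_three isOpen_univ (sm m).contDiffOn (sm n).contDiffOn (sm k).contDiffOn
    (mem_univ z) (lin_self z m) (lin_self z n) (lin_self z k)
  set w := fun y => lin z m y * lin z n y * lin z k y with hwdef
  have w0 : w z = 0 := by simp [hwdef, lin_self]
  -- The left side of `hmnk` is half of `w_txx`: the two `x`-derivatives may be interchanged.
  have w3 : pd (1, 0) (pd (0, 1) (pd (0, 1) w)) z = 0 := by
    rw [(hP (1, 0) (0, 1) (0, 1)).2.2]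
    simp only [pd_lin]
    linear_combination 2 * hmnk
  have A := fun e => pd_add isOpen_univ hs.contDiffOn hw.contDiffOn e
  have hA3 : pd (1, 0) (pd (0, 1) (pd (0, 1) (fun y => u₀ y + w y))) z = r := by
    have s1 := pd_smooth isOpen_univ hs.contDiffOn (0, 1)
    have s2 := pd_smooth isOpen_univ hw.contDiffOn (0, 1)
    rw [pd_congr isOpen_univ (pd_congr isOpen_univ (A (0, 1)) (0, 1)) (1, 0) (mem_univ z),
      pd_congr isOpen_univ (pd_add isOpen_univ s1 s2 (0, 1)) (1, 0) (mem_univ z),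
      pd_add isOpen_univ (pd_smooth isOpen_univ s1 (0, 1)) (pd_smooth isOpen_univ s2 (0, 1))
      (1, 0) (mem_univ z)]
    simp only
    rw [w3, add_zero]; exact j3
  have hAt : pd (1, 0) (fun y => u₀ y + w y) z = a := by
    rw [A (1, 0) (mem_univ z)]; simp only
    rw [(hP (1, 0) 0 0).1, add_zero]; exact j1
  have hAx : pd (0, 1) (fun y => u₀ y + w y) z = b := by
    rw [A (0, 1) (mem_univ z)]; simp only
    rw [(hP (0, 1) 0 0).1, add_zero]; exact j2
  have j0' : u₀ z = c := j0
  have j1' : pd (1, 0) u₀ z = a := j1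
  have j2' : pd (0, 1) u₀ z = b := j2
  have j3' : pd (1, 0) (pd (0, 1) (pd (0, 1) u₀)) z = r := j3
  refine ⟨u₀, hs, ⟨j0', j1', j2', ?_⟩, hs.add hw, hAt, hAx, ?_⟩
  · rw [holdsAt_iff_pd E isOpen_univ hs.contDiffOn (mem_univ z), j0', j1', j2', j3']
    linear_combination hrh
  · rw [holdsAt_iff_pd E isOpen_univ (hs.add hw).contDiffOn (mem_univ z), hAt, hAx, hA3, j0']
    change a + E.f z.1 * b + E.g z.1 * (c + w z) * b + E.h z.1 * r = 0
    rw [w0]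
    linear_combination hrh

/-! ### The cubic symbol under a point transformation -/

namespace PointTransformation

variable (Φ : PointTransformation)

/-- The total derivatives of the new independent variables. -/
theorem pd_newPt {u : ℝ × ℝ → ℝ} {V : Set (ℝ × ℝ)} (hV : IsOpen V) (hu : ContDiffOn ℝ ∞ u V)
    (hm : ∀ z ∈ V, graphPt u z ∈ Φ.dom) {z : ℝ × ℝ} (hz : z ∈ V) (e : ℝ × ℝ) :
    pd e (fun z => (Φ.newPt u z).1) z = pd (e.1, e.2, 0) (fun p => (Φ.map p).1) (graphPt u z)
      + pd (0, 0, 1) (fun p => (Φ.map p).1) (graphPt u z) * pd e u z ∧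
    pd e (fun z => (Φ.newPt u z).2) z = pd (e.1, e.2, 0) (fun p => (Φ.map p).2.1) (graphPt u z)
      + pd (0, 0, 1) (fun p => (Φ.map p).2.1) (graphPt u z) * pd e u z :=
  ⟨pd_comp_graphPt Φ.isOpen_dom hV Φ.smooth_T hu hm e hz,
    pd_comp_graphPt Φ.isOpen_dom hV Φ.smooth_X hu hm e hz⟩

/-- The difference of the two sides of the equation `U = v(T, X)` of the image of a graph. -/
noncomputable def residual (v : ℝ × ℝ → ℝ) : ℝ × ℝ × ℝ → ℝ := fun p =>
  (Φ.map p).2.2 - v ((Φ.map p).1, (Φ.map p).2.1)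

theorem isOpen_preimage_newVars {W : Set (ℝ × ℝ)} (hW : IsOpen W) :
    IsOpen (Φ.dom ∩ (fun p => ((Φ.map p).1, (Φ.map p).2.1)) ⁻¹' W) :=
  (Φ.smooth_T.continuousOn.prodMk Φ.smooth_X.continuousOn).isOpen_inter_preimage Φ.isOpen_dom hW

variable {Φ} in
theorem TakesTo.residual_smooth {V W : Set (ℝ × ℝ)} {u v : ℝ × ℝ → ℝ} (h : Φ.TakesTo V u W v) :
    ContDiffOn ℝ ∞ (Φ.residual v)
      (Φ.dom ∩ (fun p => ((Φ.map p).1, (Φ.map p).2.1)) ⁻¹' W) :=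
  (Φ.smooth_U.mono inter_subset_left).sub (h.smooth_target.comp
    ((Φ.smooth_T.prodMk Φ.smooth_X).mono inter_subset_left) fun _ hp => hp.2)

variable {Φ} in
theorem TakesTo.residual_eq_zero {V W : Set (ℝ × ℝ)} {u v : ℝ × ℝ → ℝ} (h : Φ.TakesTo V u W v) :
    ∀ z ∈ V, Φ.residual v (graphPt u z) = 0 := by
  intro z hz
  have := congrArg (fun p => p.2.2) (h.map_graph z hz)
  simp only [residual]
  rw [sub_eq_zero]; exact this

-- The residual vanishes along the graph, so if its `u`-derivative vanished at a point, its whole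
-- differential would. But some direction has `dT = dX = 0` and `dU = 1`, and there the residual has
-- derivative 1.
variable {Φ} in
theorem TakesTo.pd_residual_ne_zero {V W : Set (ℝ × ℝ)} {u v : ℝ × ℝ → ℝ}
    (h : Φ.TakesTo V u W v) {z : ℝ × ℝ} (hz : z ∈ V) :
    pd (0, 0, 1) (Φ.residual v) (graphPt u z) ≠ 0 := by
  intro h3
  have hO := Φ.isOpen_preimage_newVars h.isOpen_target
  set O := Φ.dom ∩ (fun p => ((Φ.map p).1, (Φ.map p).2.1)) ⁻¹' W with hOdef
  have hmem : ∀ z ∈ V, graphPt u z ∈ O := fun z hz => ⟨h.graph_mem z hz, h.newPt_mem z hz⟩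
  have hp := hmem z hz
  have hR := h.residual_smooth
  have hbase : ∀ e : ℝ × ℝ, pd (e.1, e.2, 0) (Φ.residual v) (graphPt u z) = 0 := by
    intro e
    have h1 := pd_comp_graphPt hO h.isOpen_source hR h.smooth_source hmem e hz
    rw [pd_zero_of_eqOn h.isOpen_source h.residual_eq_zero e z hz] at h1
    simpa [h3] using h1.symm
  obtain ⟨e, he1, he2, he3⟩ := Φ.exists_pd_eq (h.graph_mem z hz) (0, 0, 1)
  have hsplit : pd e (Φ.residual v) (graphPt u z) = 0 := by
    have : e = (e.1, e.2.1, 0) + e.2.2 • ((0 : ℝ), (0 : ℝ), (1 : ℝ)) := by simp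
    have h1 := hbase (e.1, e.2.1)
    simp only [pd] at h1 h3 ⊢
    rw [this, map_add, map_smul]
    simp [h1, h3]
  have sT := Φ.smooth_T.mono (inter_subset_left : O ⊆ _)
  have sX := Φ.smooth_X.mono (inter_subset_left : O ⊆ _)
  have sU := Φ.smooth_U.mono (inter_subset_left : O ⊆ _)
  have hcomp := pd_comp_pair hO h.isOpen_target h.smooth_target sT sX (fun p hp => hp.2) e hp
  have hsub := pd_sub (F := fun p => (Φ.map p).2.2) hO sU (h.smooth_target.comp
    (sT.prodMk sX) fun _ hp => hp.2) e hp
  have hsub' : pd e (Φ.residual v) (graphPt u z) = pd e (fun p => (Φ.map p).2.2) (graphPt u z) -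
    pd e (fun p => v ((Φ.map p).1, (Φ.map p).2.1)) (graphPt u z) := hsub
  rw [hsplit, hcomp] at hsub'
  simp [he1, he2, he3] at hsub'

/-- The effect of a perturbation of third order of a solution on the terms of third order of the
new equation. -/
theorem MapsEquation.third_order {Φ : PointTransformation} {E E' : Equation}
    (hM : Φ.MapsEquation E E') {z : ℝ × ℝ} {c : ℝ} (hp : (z.1, z.2, c) ∈ Φ.dom) (a b : ℝ)
    {Tt Tx Xt Xx : ℝ}
    (hTt : Tt = pd (1, 0, 0) (fun p => (Φ.map p).1) (z.1, z.2, c)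
      + pd (0, 0, 1) (fun p => (Φ.map p).1) (z.1, z.2, c) * a)
    (hTx : Tx = pd (0, 1, 0) (fun p => (Φ.map p).1) (z.1, z.2, c)
      + pd (0, 0, 1) (fun p => (Φ.map p).1) (z.1, z.2, c) * b)
    (hXt : Xt = pd (1, 0, 0) (fun p => (Φ.map p).2.1) (z.1, z.2, c)
      + pd (0, 0, 1) (fun p => (Φ.map p).2.1) (z.1, z.2, c) * a)
    (hXx : Xx = pd (0, 1, 0) (fun p => (Φ.map p).2.1) (z.1, z.2, c)
      + pd (0, 0, 1) (fun p => (Φ.map p).2.1) (z.1, z.2, c) * b)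
    (hJ : Tt * Xx - Tx * Xt ≠ 0)
    {m n k : ℝ × ℝ} (hmnk : m.2 * n.2 * k.1 + m.2 * n.1 * k.2 + m.1 * n.2 * k.2 = 0) :
    (m.2 * Tt - m.1 * Tx) * (n.2 * Tt - n.1 * Tx) * (k.1 * Xx - k.2 * Xt)
      + (m.2 * Tt - m.1 * Tx) * (n.1 * Xx - n.2 * Xt) * (k.2 * Tt - k.1 * Tx)
      + (m.1 * Xx - m.2 * Xt) * (n.2 * Tt - n.1 * Tx) * (k.2 * Tt - k.1 * Tx) = 0 := by
  have hh : E.h z.1 ≠ 0 := E.h_ne_zero _ (hM.1 hp)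
  obtain ⟨u₀, hu₀, ⟨u0, ut, ux, hE0⟩, hu, vt, vx, hE⟩ := perturbed_jet (E := E) c a b hh hmnk
  set w := fun y => lin z m y * lin z n y * lin z k y with hw
  set u := fun y => u₀ y + w y with hudef
  have w0 : w z = 0 := by simp [hw, lin_self]
  have uz : u z = c := by simp [hudef, w0, u0]
  have hg0 : graphPt u₀ z = (z.1, z.2, c) := by simp [graphPt, u0]
  have hg : graphPt u z = (z.1, z.2, c) := by simp [graphPt, uz]
  have hfw : ∀ {u : ℝ × ℝ → ℝ}, ContDiff ℝ ∞ u → graphPt u z = (z.1, z.2, c) →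
      pd (1, 0) u z = a → pd (0, 1) u z = b →
      pd (1, 0) (fun z => (Φ.newPt u z).1) z = Tt ∧ pd (0, 1) (fun z => (Φ.newPt u z).1) z = Tx ∧
      pd (1, 0) (fun z => (Φ.newPt u z).2) z = Xt ∧
      pd (0, 1) (fun z => (Φ.newPt u z).2) z = Xx := by
    intro u hu hg ha hb
    have hgs : ContDiff ℝ ∞ (graphPt u) := contDiff_fst.prodMk (contDiff_snd.prodMk hu)
    have h := fun e => Φ.pd_newPt (Φ.isOpen_dom.preimage hgs.continuous) hu.contDiffOn
      (fun _ h => h) (by change graphPt u z ∈ Φ.dom; rw [hg]; exact hp) e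
    rw [(h (1, 0)).1, (h (1, 0)).2, (h (0, 1)).1, (h (0, 1)).2, hg, ha, hb, hTt, hTx, hXt, hXx]
    exact ⟨rfl, rfl, rfl, rfl⟩
  obtain ⟨a1, a2, a3, a4⟩ := hfw hu₀ hg0 ut ux
  obtain ⟨b1, b2, b3, b4⟩ := hfw hu hg vt vx
  obtain ⟨V₀, W₀, v₀, -, hzV₀, hT₀, -⟩ := Φ.exists_takesTo hu₀ (hg0 ▸ hp)
    (by rwa [a1, a2, a3, a4])
  obtain ⟨V, W, v, ψ, hzV, hT, hψ, hr, hl⟩ := Φ.exists_takesTo hu (hg ▸ hp)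
    (by rwa [b1, b2, b3, b4])
  have hN : Φ.newPt u₀ z = Φ.newPt u z := by simp only [newPt, hg, hg0]
  have hH0 := (hM.2.2 V₀ u₀ W₀ v₀ hT₀ z hzV₀).1 hE0
  have hH := (hM.2.2 V u W v hT z hzV).1 hE
  rw [hN] at hH0
  set Z := Φ.newPt u z with hZ
  have hZW : Z ∈ W := hT.newPt_mem z hzV
  have hZW₀ : Z ∈ W₀ := hN ▸ hT₀.newPt_mem z hzV₀
  have hψZ : ψ Z = z := hl z hzV
  -- the neighbourhood of `Z` on which both solutions are compared
  set W₁ := (W ∩ ψ ⁻¹' V₀) ∩ W₀ with hW₁def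
  have hW₁ : IsOpen W₁ := (hψ.continuousOn.isOpen_inter_preimage hT.isOpen_target
    hT₀.isOpen_source).inter hT₀.isOpen_target
  have hZW₁ : Z ∈ W₁ := ⟨⟨hZW, by change ψ Z ∈ V₀; rwa [hψZ]⟩, hZW₀⟩
  have hW₁W : W₁ ⊆ W := fun y hy => hy.1.1
  have sψ := hψ.mono hW₁W
  -- derivatives of the inverse change of variables
  have hinv : ∀ e : ℝ × ℝ, Tt * pd e (fun y => (ψ y).1) Z + Tx * pd e (fun y => (ψ y).2) Z = e.1 ∧
      Xt * pd e (fun y => (ψ y).1) Z + Xx * pd e (fun y => (ψ y).2) Z = e.2 := by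
    intro e
    have k1 := pd_comp_pair hT.isOpen_target hT.isOpen_source
      (comp_graphPt_smooth Φ.smooth_T hT.smooth_source hT.graph_mem) hψ.fst hψ.snd
      (fun y hy => (hr y hy).1) e hZW
    have k2 := pd_comp_pair hT.isOpen_target hT.isOpen_source
      (comp_graphPt_smooth Φ.smooth_X hT.smooth_source hT.graph_mem) hψ.fst hψ.snd
      (fun y hy => (hr y hy).1) e hZW
    have r1 := pd_congr (F := fun y => (Φ.map (graphPt u ((ψ y).1, (ψ y).2))).1)
      (G := fun y => y.1) hT.isOpen_target (fun y hy => congrArg Prod.fst (hr y hy).2) e hZW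
    have r2 := pd_congr (F := fun y => (Φ.map (graphPt u ((ψ y).1, (ψ y).2))).2.1)
      (G := fun y => y.2) hT.isOpen_target (fun y hy => congrArg Prod.snd (hr y hy).2) e hZW
    rw [r1, pd_fst] at k1
    rw [r2, pd_snd] at k2
    simp only [Prod.mk.eta, hψZ] at k1 k2
    refine ⟨?_, ?_⟩
    · rw [k1, ← b1, ← b2]; rfl
    · rw [k2, ← b3, ← b4]; rfl
  -- the perturbation in the new variables
  have sα : ∀ m, ContDiffOn ℝ ∞ (fun y => lin z m (ψ y)) W₁ := fun m =>
    (lin_smooth z m).comp_contDiffOn sψ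
  have hα0 : ∀ m, lin z m (ψ Z) = 0 := fun m => by rw [hψZ, lin_self]
  have hα1 : ∀ m e, pd e (fun y => lin z m (ψ y)) Z =
      m.1 * pd e (fun y => (ψ y).1) Z + m.2 * pd e (fun y => (ψ y).2) Z := by
    intro m e
    have k1 := pd_comp_pair hW₁ isOpen_univ (lin_smooth z m).contDiffOn sψ.fst sψ.snd
      (fun y hy => mem_univ _) e hZW₁
    simp only [pd_lin] at k1
    simpa using k1
  set s : ℝ × ℝ → ℝ := fun y => w (ψ y) with hs
  have hss : ContDiffOn ℝ ∞ s W₁ := ((sα m).mul (sα n)).mul (sα k)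
  have hP := pd_prod_three hW₁ (sα m) (sα n) (sα k) hZW₁ (hα0 m) (hα0 n) (hα0 k)
  -- the difference of the two solutions
  set κ : ℝ × ℝ × ℝ → ℝ × ℝ × ℝ := fun q =>
    ((ψ (q.1, q.2.1)).1, (ψ (q.1, q.2.1)).2, u₀ (ψ (q.1, q.2.1)) + q.2.2) with hκ
  set D := {q : ℝ × ℝ × ℝ | (q.1, q.2.1) ∈ W₁} with hDdef
  have hD : IsOpen D := hW₁.preimage (by fun_prop)
  have hπ : ContDiff ℝ ∞ (fun q : ℝ × ℝ × ℝ => (q.1, q.2.1)) := by fun_prop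
  have hψπ : ContDiffOn ℝ ∞ (fun q : ℝ × ℝ × ℝ => ψ (q.1, q.2.1)) D :=
    sψ.comp hπ.contDiffOn fun _ h => h
  have hκs : ContDiffOn ℝ ∞ κ D := hψπ.fst.prodMk (hψπ.snd.prodMk
    ((hu₀.comp_contDiffOn hψπ).add contDiff_snd.snd.contDiffOn))
  have hQ := Φ.isOpen_preimage_newVars hT₀.isOpen_target
  set Q := Φ.dom ∩ (fun p => ((Φ.map p).1, (Φ.map p).2.1)) ⁻¹' W₀ with hQdef
  have hO : IsOpen (D ∩ κ ⁻¹' Q) := hκs.continuousOn.isOpen_inter_preimage hD hQ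
  have hRs := hT₀.residual_smooth
  -- `F` is the residual of `v₀` over the graph of `u₀`, displaced by the last coordinate along the
  -- fibre. It vanishes at displacement 0 and equals `v - v₀` at displacement `s`; since `s`
  -- vanishes to second order at `Z`, the jets of `v` and `v₀` differ only from third order on.
  set F : ℝ × ℝ × ℝ → ℝ := fun q => Φ.residual v₀ (κ q) with hF
  have hFs : ContDiffOn ℝ ∞ F (D ∩ κ ⁻¹' Q) :=
    hRs.comp (hκs.mono inter_subset_left) fun _ h => h.2
  have hκ0 : ∀ y, κ (graphPt (fun _ => 0) y) = graphPt u₀ (ψ y) := fun y => by simp [hκ, graphPt]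
  have hκs' : ∀ y, κ (graphPt s y) = graphPt u (ψ y) := fun y => by
    simp [hκ, graphPt, hudef, hs]
  have hm0 : ∀ y ∈ W₁, graphPt (fun _ => 0) y ∈ D ∩ κ ⁻¹' Q := by
    intro y hy
    refine ⟨hy, ?_⟩
    rw [mem_preimage, hκ0]
    exact ⟨hT₀.graph_mem _ hy.1.2, hT₀.newPt_mem _ hy.1.2⟩
  have hms : ∀ y ∈ W₁, graphPt s y ∈ D ∩ κ ⁻¹' Q := by
    intro y hy
    refine ⟨hy, ?_⟩
    rw [mem_preimage, hκs']
    refine ⟨hT.graph_mem _ (hr y hy.1.1).1, ?_⟩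
    change Φ.newPt u (ψ y) ∈ W₀
    rw [(hr y hy.1.1).2]; exact hy.2
  have hF0 : ∀ y ∈ W₁, F (graphPt (fun _ => 0) y) = 0 := by
    intro y hy
    simp only [hF]; rw [hκ0]; exact hT₀.residual_eq_zero _ hy.1.2
  have hFd : EqOn (fun y => v y - v₀ y) (fun y => F (graphPt s y)) W₁ := by
    intro y hy
    obtain ⟨hyV, hyN⟩ := hr y hy.1.1
    have h1 := congrArg (fun p => p.2.2) (hT.map_graph _ hyV)
    rw [hyN] at h1
    have h2 : ((Φ.map (graphPt u (ψ y))).1, (Φ.map (graphPt u (ψ y))).2.1) = y := hyN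
    simp only [hF, residual]
    rw [hκs', h2]
    simp only [graphPt] at h1 ⊢
    rw [h1]
  obtain ⟨d0, d1, d3⟩ := pd_comp_graphPt_of_flat hO hW₁ hFs hss hms hm0 hF0 hZW₁
    (by simp [hs, hw, hα0]) (fun e => (hP e 0 0).1) (fun e f => (hP e f 0).2.1)
  have sv := hT.smooth_target.mono hW₁W
  have sv₀ := hT₀.smooth_target.mono (fun y (hy : y ∈ W₁) => hy.2)
  have e0 : v Z = v₀ Z := by have := hFd hZW₁; simp only at this; linarith [d0]
  have e1 : ∀ e, pd e v Z = pd e v₀ Z := by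
    intro e
    have h1 := pd_congr hW₁ hFd e hZW₁
    rw [d1 e, pd_sub hW₁ sv sv₀ e hZW₁] at h1
    simp only at h1; linarith
  have e3 : pd (1, 0) (pd (0, 1) (pd (0, 1) v)) Z - pd (1, 0) (pd (0, 1) (pd (0, 1) v₀)) Z =
      pd (0, 0, 1) F (graphPt (fun _ => 0) Z) * pd (1, 0) (pd (0, 1) (pd (0, 1) s)) Z := by
    have t1 := pd_smooth hW₁ sv (0, 1)
    have t2 := pd_smooth hW₁ sv₀ (0, 1)
    have t3 := pd_smooth hW₁ t1 (0, 1)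
    have t4 := pd_smooth hW₁ t2 (0, 1)
    rw [← d3, ← pd_congr hW₁ (pd_congr hW₁ (pd_congr hW₁ hFd (0, 1)) (0, 1)) (1, 0) hZW₁,
      pd_congr hW₁ (pd_congr hW₁ (pd_sub hW₁ sv sv₀ (0, 1)) (0, 1)) (1, 0) hZW₁,
      pd_congr hW₁ (pd_sub hW₁ t1 t2 (0, 1)) (1, 0) hZW₁, pd_sub hW₁ t3 t4 (1, 0) hZW₁]
  have hF3 : pd (0, 0, 1) F (graphPt (fun _ => 0) Z) ≠ 0 := by
    have hne := hT₀.pd_residual_ne_zero hzV₀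
    have hq := hm0 Z hZW₁
    have l1 := (smoothOn_differentiableAt hO hFs hq).lineDeriv_eq_fderiv (v := (0, 0, 1))
    have hq2 : graphPt u₀ z ∈ Q := ⟨hT₀.graph_mem _ hzV₀, hT₀.newPt_mem _ hzV₀⟩
    have l2 := (smoothOn_differentiableAt hQ hRs hq2).lineDeriv_eq_fderiv (v := (0, 0, 1))
    -- On the fibre `κ` is a translation of the last coordinate, so the two restrictions to a line
    -- are the same function.
    have : lineDeriv ℝ F (graphPt (fun _ => 0) Z) (0, 0, 1) =
        lineDeriv ℝ (Φ.residual v₀) (graphPt u₀ z) (0, 0, 1) := by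
      simp only [lineDeriv]
      congr 1
      funext r
      simp [hF, hκ, graphPt, hψZ]
    simp only [pd] at hne ⊢
    rw [← l1, this, l2]; exact hne
  rw [holdsAt_iff_pd E' hW₁ sv hZW₁] at hH
  rw [holdsAt_iff_pd E' hW₁ sv₀ hZW₁] at hH0
  have hh' : E'.h Z.1 ≠ 0 := E'.h_ne_zero _ (hM.2.1 (hg ▸ hp : graphPt u z ∈ Φ.dom))
  -- Subtracting the two instances of (E') leaves the third-order terms alone, with the nonzero
  -- factors `E'.h` and `F_u`.
  have hs3 : pd (1, 0) (pd (0, 1) (pd (0, 1) s)) Z = 0 := by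
    rw [e0, e1, e1] at hH
    have h1 : E'.h Z.1 * (pd (0, 0, 1) F (graphPt (fun _ => 0) Z)
        * pd (1, 0) (pd (0, 1) (pd (0, 1) s)) Z) = 0 := by
      rw [← e3]; linear_combination hH - hH0
    simpa [hh', hF3] using h1
  have hs3' := (hP (1, 0) (0, 1) (0, 1)).2.2
  have hs3'' : pd (1, 0) (pd (0, 1) (pd (0, 1)
    (fun y => lin z m (ψ y) * lin z n (ψ y) * lin z k (ψ y)))) Z = 0 := hs3
  rw [hs3''] at hs3'
  simp only [hα1] at hs3'
  obtain ⟨i1, i2⟩ := hinv (1, 0)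
  obtain ⟨i3, i4⟩ := hinv (0, 1)
  set p1 := pd (1, 0) (fun y => (ψ y).1) Z
  set p2 := pd (1, 0) (fun y => (ψ y).2) Z
  set p3 := pd (0, 1) (fun y => (ψ y).1) Z
  set p4 := pd (0, 1) (fun y => (ψ y).2) Z
  simp only at i1 i2 i3 i4
  -- Cramer's rule for the derivative of `ψ`, multiplied by the determinant.
  have f1 : Xx = (Tt * Xx - Tx * Xt) * p1 := by linear_combination -Xx * i1 + Tx * i2
  have f2 : -Xt = (Tt * Xx - Tx * Xt) * p2 := by linear_combination Xt * i1 - Tt * i2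
  have f3 : -Tx = (Tt * Xx - Tx * Xt) * p3 := by linear_combination -Xx * i3 + Tx * i4
  have f4 : Tt = (Tt * Xx - Tx * Xt) * p4 := by linear_combination Xt * i3 - Tt * i4
  have g1 : ∀ m : ℝ × ℝ, m.2 * Tt - m.1 * Tx = (Tt * Xx - Tx * Xt) * (m.1 * p3 + m.2 * p4) :=
    fun m => by linear_combination m.2 * f4 + m.1 * f3
  have g2 : ∀ m : ℝ × ℝ, m.1 * Xx - m.2 * Xt = (Tt * Xx - Tx * Xt) * (m.1 * p1 + m.2 * p2) :=
    fun m => by linear_combination m.1 * f1 + m.2 * f2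
  rw [g1, g1, g1, g2, g2, g2]
  linear_combination (-1 / 2) * (Tt * Xx - Tx * Xt) ^ 3 * hs3'

end PointTransformation

theorem pd_comp_fst {I : Set ℝ} {O : Set (ℝ × ℝ × ℝ)} {k : ℝ → ℝ} (hI : IsOpen I)
    (hk : ContDiffOn ℝ ∞ k I) (hO : ∀ p ∈ O, p.1 ∈ I) :
    ContDiffOn ℝ ∞ (fun p : ℝ × ℝ × ℝ => k p.1) O ∧
      ∀ p ∈ O, ∀ e, pd e (fun p : ℝ × ℝ × ℝ => k p.1) p = deriv k p.1 * e.1 := by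
  refine ⟨hk.comp contDiffOn_fst hO, fun p hp e => ?_⟩
  have h1 : HasDerivAt k (deriv k p.1) p.1 :=
    ((hk.contDiffAt (hI.mem_nhds (hO p hp))).differentiableAt (by simp)).hasDerivAt
  have h2 : fderiv ℝ (fun p : ℝ × ℝ × ℝ => k p.1) p = _ :=
    (h1.hasFDerivAt.comp p hasFDerivAt_fst).fderiv
  simp only [pd, h2]
  simp [mul_comm]

/-! ### Separation of the variables and the pulled-back equation -/

namespace PointTransformation

/-- The new independent variables do not mix the old ones. -/
theorem MapsEquation.fiber_preserving {Φ : PointTransformation} {E E' : Equation}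
    (hM : Φ.MapsEquation E E') {p : ℝ × ℝ × ℝ} (hp : p ∈ Φ.dom) :
    (pd (0, 1, 0) (fun p => (Φ.map p).1) p = 0 ∧ pd (0, 0, 1) (fun p => (Φ.map p).1) p = 0) ∧
    (pd (1, 0, 0) (fun p => (Φ.map p).2.1) p = 0 ∧ pd (0, 0, 1) (fun p => (Φ.map p).2.1) p = 0) ∧
    pd (1, 0, 0) (fun p => (Φ.map p).1) p ≠ 0 ∧ pd (0, 1, 0) (fun p => (Φ.map p).2.1) p ≠ 0 ∧
    pd (0, 0, 1) (fun p => (Φ.map p).2.2) p ≠ 0 := by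
  obtain ⟨t, x, c⟩ := p
  have key := fun a b => hM.third_order (z := (t, x)) (c := c) hp a b rfl rfl rfl rfl
  simp only at key
  have hex := Φ.exists_pd_eq hp
  have hsplit : ∀ (e : ℝ × ℝ × ℝ) (F : ℝ × ℝ × ℝ → ℝ), pd e F (t, x, c) =
      e.1 * pd (1, 0, 0) F (t, x, c) + e.2.1 * pd (0, 1, 0) F (t, x, c)
      + e.2.2 * pd (0, 0, 1) F (t, x, c) := by
    intro e F
    have : e = e.1 • ((1 : ℝ), (0 : ℝ), (0 : ℝ)) + e.2.1 • ((0 : ℝ), (1 : ℝ), (0 : ℝ))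
      + e.2.2 • ((0 : ℝ), (0 : ℝ), (1 : ℝ)) := by simp
    simp only [pd]
    conv_lhs => rw [this]
    simp only [map_add, map_smul, smul_eq_mul]
  have hex' := fun y => (hex y).imp fun e he => by
    rw [hsplit e, hsplit e, hsplit e] at he; exact he
  clear hex
  set T1 := pd (1, 0, 0) (fun p => (Φ.map p).1) (t, x, c)
  set T2 := pd (0, 1, 0) (fun p => (Φ.map p).1) (t, x, c)
  set T3 := pd (0, 0, 1) (fun p => (Φ.map p).1) (t, x, c)
  set X1 := pd (1, 0, 0) (fun p => (Φ.map p).2.1) (t, x, c)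
  set X2 := pd (0, 1, 0) (fun p => (Φ.map p).2.1) (t, x, c)
  set X3 := pd (0, 0, 1) (fun p => (Φ.map p).2.1) (t, x, c)
  set U3 := pd (0, 0, 1) (fun p => (Φ.map p).2.2) (t, x, c)
  have main : ∀ a b, (T1 + T3 * a) * (X2 + X3 * b) - (T2 + T3 * b) * (X1 + X3 * a) ≠ 0 →
      T2 + T3 * b = 0 ∧ X1 + X3 * a = 0 := by
    intro a b hJ
    -- The perturbations `x³`, `t³` and `xt²`, all with zero `txx`-derivative. The first two still
    -- allow an exchange of `t` and `x` (`A = D = 0`); the third excludes it.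
    have k1 := key a b hJ (m := (0, 1)) (n := (0, 1)) (k := (0, 1)) (by norm_num)
    have k2 := key a b hJ (m := (1, 0)) (n := (1, 0)) (k := (1, 0)) (by norm_num)
    have k3 := key a b hJ (m := (0, 1)) (n := (1, 0)) (k := (1, 0)) (by norm_num)
    simp only at k1 k2 k3
    generalize T1 + T3 * a = A at *
    generalize T2 + T3 * b = B at *
    generalize X1 + X3 * a = C at *
    generalize X2 + X3 * b = D at *
    have k1' : A * A * C = 0 := by linear_combination (-1 / 3) * k1
    have k2' : B * B * D = 0 := by linear_combination (1 / 3) * k2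
    have hA : A ≠ 0 := by
      rintro rfl
      have h1 : B * (B * C) = 0 := by linear_combination -k3
      apply hJ
      rcases mul_eq_zero.1 h1 with h | h
      · rw [h]; ring
      · linear_combination -h
    have hC : C = 0 := by simpa [hA] using k1'
    have hD : D ≠ 0 := by
      rintro rfl; apply hJ; rw [hC]; ring
    exact ⟨by simpa [hD] using k2', hC⟩
  -- The determinant is affine in `(a, b)`, and its coefficients are the `2 × 2` minors of the
  -- differentials of `T` and `X`. If all vanished, these differentials would be dependent.
  have hJ : ∃ a b, (T1 + T3 * a) * (X2 + X3 * b) - (T2 + T3 * b) * (X1 + X3 * a) ≠ 0 := by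
    by_contra! h
    have h00 := h 0 0
    have h10 := h 1 0
    have h01 := h 0 1
    obtain ⟨e, e1, e2, -⟩ := hex' (1, 0, 0)
    obtain ⟨d, d1, d2, -⟩ := hex' (0, 1, 0)
    simp only at e1 e2 d1 d2
    have m1 : T1 * X2 - T2 * X1 = 0 := by linear_combination h00
    have m2 : T3 * X2 - T2 * X3 = 0 := by linear_combination h10 - h00
    have m3 : T1 * X3 - T3 * X1 = 0 := by linear_combination h01 - h00
    have : (1 : ℝ) = 0 := by
      have h1 : (e.1 * T1 + e.2.1 * T2 + e.2.2 * T3) * (d.1 * X1 + d.2.1 * X2 + d.2.2 * X3)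
        - (d.1 * T1 + d.2.1 * T2 + d.2.2 * T3) * (e.1 * X1 + e.2.1 * X2 + e.2.2 * X3) = 0 := by
        linear_combination (e.1 * d.2.1 - e.2.1 * d.1) * m1
          + (e.2.2 * d.2.1 - e.2.1 * d.2.2) * m2 + (e.1 * d.2.2 - e.2.2 * d.1) * m3
      rw [e1, e2, d1, d2] at h1
      linarith
    exact one_ne_zero this
  obtain ⟨a, b, hab⟩ := hJ
  obtain ⟨hb, ha⟩ := main a b hab
  -- Being affine in `a` and nonzero at `a`, the determinant is nonzero at `a + 1` or at `a - 1`. So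
  -- `X1 + X3 * a` vanishes for two values of `a`. The same is done with `b` for `T3`.
  have hX3 : X3 = 0 := by
    by_cases h : (T1 + T3 * (a + 1)) * (X2 + X3 * b) - (T2 + T3 * b) * (X1 + X3 * (a + 1)) = 0
    · have := (main (a - 1) b (fun h' => hab (by linear_combination (h + h') / 2))).2
      linear_combination ha - this
    · have := (main _ _ h).2
      linear_combination this - ha
  have hT3 : T3 = 0 := by
    by_cases h : (T1 + T3 * a) * (X2 + X3 * (b + 1)) - (T2 + T3 * (b + 1)) * (X1 + X3 * a) = 0
    · have := (main a (b - 1) (fun h' => hab (by linear_combination (h + h') / 2))).1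
      linear_combination hb - this
    · have := (main _ _ h).1
      linear_combination this - hb
  have hX1 : X1 = 0 := by simpa [hX3] using ha
  have hT2 : T2 = 0 := by simpa [hT3] using hb
  have hprod : T1 * X2 ≠ 0 := by simpa [hX3, hT3, hX1, hT2] using hab
  refine ⟨⟨hT2, hT3⟩, ⟨hX1, hX3⟩, left_ne_zero_of_mul hprod, right_ne_zero_of_mul hprod, ?_⟩
  intro hU3
  obtain ⟨e, e1, e2, e3⟩ := hex' (0, 0, 1)
  rw [hT2, hT3] at e1
  rw [hX1, hX3] at e2
  rw [hU3] at e3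
  have z1 : e.1 = 0 := by simpa [left_ne_zero_of_mul hprod] using e1
  have z2 : e.2.1 = 0 := by simpa [right_ne_zero_of_mul hprod] using e2
  simp [z1, z2] at e3

/-- The new equation, written in the old variables for a solution with a prescribed jet. -/
theorem MapsEquation.jet_identity {Φ : PointTransformation} {E E' : Equation}
    (hM : Φ.MapsEquation E E') {p : ℝ × ℝ × ℝ} (hp : p ∈ Φ.dom) (a b k q : ℝ) :
    ∃ (u : ℝ × ℝ → ℝ) (V : Set (ℝ × ℝ)), IsOpen V ∧ ContDiffOn ℝ ∞ u V ∧ (p.1, p.2.1) ∈ V ∧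
      (∀ z ∈ V, graphPt u z ∈ Φ.dom) ∧ graphPt u (p.1, p.2.1) = p ∧
      pd (1, 0) u (p.1, p.2.1) = a ∧ pd (0, 1) u (p.1, p.2.1) = b ∧
      pd (1, 0) (pd (0, 1) u) (p.1, p.2.1) = q ∧ pd (0, 1) (pd (0, 1) u) (p.1, p.2.1) = k ∧
      E.h p.1 * pd (1, 0) (pd (0, 1) (pd (0, 1) u)) (p.1, p.2.1)
        = -(a + (E.f p.1 + E.g p.1 * p.2.2) * b) ∧
      pd (0, 1, 0) (fun p => (Φ.map p).2.1) p ^ 3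
          * pd (1, 0) (fun z => (Φ.map (graphPt u z)).2.2) (p.1, p.2.1)
        + pd (1, 0, 0) (fun p => (Φ.map p).1) p * pd (0, 1, 0) (fun p => (Φ.map p).2.1) p ^ 2
          * (E'.f (Φ.map p).1 + E'.g (Φ.map p).1 * (Φ.map p).2.2)
          * pd (0, 1) (fun z => (Φ.map (graphPt u z)).2.2) (p.1, p.2.1)
        + E'.h (Φ.map p).1 * (pd (0, 1, 0) (fun p => (Φ.map p).2.1) p
          * pd (1, 0) (pd (0, 1) (pd (0, 1) (fun z => (Φ.map (graphPt u z)).2.2))) (p.1, p.2.1)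
          - pd (0, 1, 0) (pd (0, 1, 0) (fun p => (Φ.map p).2.1)) p
          * pd (1, 0) (pd (0, 1) (fun z => (Φ.map (graphPt u z)).2.2)) (p.1, p.2.1)) = 0 := by
  obtain ⟨t, x, c⟩ := p
  have hh : E.h t ≠ 0 := E.h_ne_zero _ (hM.1 hp)
  set r := -(a + (E.f t + E.g t * c) * b) / E.h t with hr
  have hrh : E.h t * r = -(a + (E.f t + E.g t * c) * b) := by rw [hr]; field_simp
  obtain ⟨j0, j1, j2, j3, j4, j5⟩ := pd_jetPoly t x c a b k q r
  have hu := jetPoly_smooth t x c a b k q r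
  generalize jetPoly t x c a b k q r = u at *
  have hg : graphPt u (t, x) = (t, x, c) := by simp [graphPt, j0]
  have fp := fun p hp => hM.fiber_preserving (p := p) hp
  obtain ⟨⟨T2, T3⟩, ⟨X1, X3⟩, T1, X2, -⟩ := fp _ hp
  have hgs : ContDiff ℝ ∞ (graphPt u) := contDiff_fst.prodMk (contDiff_snd.prodMk hu)
  have hD := fun e => Φ.pd_newPt (Φ.isOpen_dom.preimage hgs.continuous) hu.contDiffOn
      (fun _ h => h) (z := (t, x)) (by change graphPt u (t, x) ∈ Φ.dom; rw [hg]; exact hp) e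
  obtain ⟨V, W, v, ψ, hzV, hT, -⟩ := Φ.exists_takesTo hu (hg ▸ hp) (by
    rw [(hD (1, 0)).1, (hD (1, 0)).2, (hD (0, 1)).1, (hD (0, 1)).2, hg, T2, T3, X1, X3]
    simpa using ⟨T1, X2⟩)
  have hE : E.HoldsAt u (t, x) := by
    rw [holdsAt_iff_pd E isOpen_univ hu.contDiffOn (mem_univ _), j0, j1, j2, j5]
    linear_combination hrh
  have hE' := (hM.2.2 V u W v hT _ hzV).1 hE
  rw [holdsAt_iff_pd E' hT.isOpen_target hT.smooth_target (hT.newPt_mem _ hzV)] at hE'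
  have hV := hT.isOpen_source
  have hW := hT.isOpen_target
  have huV := hT.smooth_source
  have hmem := hT.graph_mem
  refine ⟨u, V, hV, huV, hzV, hmem, hg, j1, j2, j3, j4, by rw [j5]; exact hrh, ?_⟩
  have hO := Φ.isOpen_dom
  have sT := Φ.smooth_T
  have sX := Φ.smooth_X
  set fT := fun p => (Φ.map p).1
  set fX := fun p => (Φ.map p).2.1
  have sXx := pd_smooth hO sX (0, 1, 0)
  have sXxx := pd_smooth hO sXx (0, 1, 0)
  have g0 : ∀ e, ∀ z ∈ V, pd e (fun z => fT (graphPt u z)) z = e.1 * pd (1, 0, 0) fT (graphPt u z) ∧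
      pd e (fun z => fX (graphPt u z)) z = e.2 * pd (0, 1, 0) fX (graphPt u z) := by
    intro e z hz
    obtain ⟨⟨T2, T3⟩, ⟨X1, X3⟩, -⟩ := fp _ (hmem z hz)
    rw [pd_comp_graphPt hO hV sT huV hmem e hz, pd_comp_graphPt hO hV sX huV hmem e hz]
    have hs : ∀ F : ℝ × ℝ × ℝ → ℝ, pd (e.1, e.2, 0) F (graphPt u z) =
        e.1 * pd (1, 0, 0) F (graphPt u z) + e.2 * pd (0, 1, 0) F (graphPt u z) := by
      intro F
      have : ((e.1, e.2, 0) : ℝ × ℝ × ℝ) =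
        e.1 • ((1 : ℝ), (0 : ℝ), (0 : ℝ)) + e.2 • ((0 : ℝ), (1 : ℝ), (0 : ℝ)) := by simp
      simp only [pd]
      rw [this]
      simp only [map_add, map_smul, smul_eq_mul]
    simp only [hs]
    rw [T2, T3, X1, X3]
    constructor <;> ring
  -- As `X_t = X_u = 0` throughout the domain, `X_x` and `X_xx` do not vary with `t` or `u`.
  have X21 : ∀ q ∈ Φ.dom, pd (1, 0, 0) (pd (0, 1, 0) fX) q = 0 := fun q hq => by
    rw [pd_comm hO sX _ _ hq]
    exact pd_zero_of_eqOn hO (fun q hq => (fp q hq).2.1.1) _ q hq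
  have X23 : ∀ q ∈ Φ.dom, pd (0, 0, 1) (pd (0, 1, 0) fX) q = 0 := fun q hq => by
    rw [pd_comm hO sX _ _ hq]
    exact pd_zero_of_eqOn hO (fun q hq => (fp q hq).2.1.2) _ q hq
  have X221 : ∀ q ∈ Φ.dom, pd (1, 0, 0) (pd (0, 1, 0) (pd (0, 1, 0) fX)) q = 0 := fun q hq => by
    rw [pd_comm hO sXx _ _ hq]; exact pd_zero_of_eqOn hO X21 _ q hq
  have X223 : ∀ q ∈ Φ.dom, pd (0, 0, 1) (pd (0, 1, 0) (pd (0, 1, 0) fX)) q = 0 := fun q hq => by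
    rw [pd_comm hO sXx _ _ hq]; exact pd_zero_of_eqOn hO X23 _ q hq
  have sγT := comp_graphPt_smooth sT huV hmem
  have sγX := comp_graphPt_smooth sX huV hmem
  have sχ := comp_graphPt_smooth sXx huV hmem
  have sχ' := comp_graphPt_smooth sXxx huV hmem
  -- derivatives of a function of the new variables
  have vD : ∀ {w : ℝ × ℝ → ℝ}, ContDiffOn ℝ ∞ w W →
      ContDiffOn ℝ ∞ (fun z => w (fT (graphPt u z), fX (graphPt u z))) V ∧
      ∀ z ∈ V, pd (1, 0) (fun z => w (fT (graphPt u z), fX (graphPt u z))) z =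
        pd (1, 0) w (fT (graphPt u z), fX (graphPt u z)) * pd (1, 0, 0) fT (graphPt u z) ∧
      pd (0, 1) (fun z => w (fT (graphPt u z), fX (graphPt u z))) z =
        pd (0, 1) w (fT (graphPt u z), fX (graphPt u z)) * pd (0, 1, 0) fX (graphPt u z) := by
    intro w hw
    refine ⟨hw.comp (sγT.prodMk sγX) fun z hz => hT.newPt_mem z hz, fun z hz => ?_⟩
    rw [pd_comp_pair hV hW hw sγT sγX (fun z hz => hT.newPt_mem z hz) _ hz,
      pd_comp_pair hV hW hw sγT sγX (fun z hz => hT.newPt_mem z hz) _ hz]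
    simp only
    rw [(g0 _ z hz).1, (g0 _ z hz).2, (g0 _ z hz).1, (g0 _ z hz).2]
    constructor <;> ring
  have s0 := hT.smooth_target
  have s1 := pd_smooth hW s0 (0, 1)
  have s2 := pd_smooth hW s1 (0, 1)
  have hN0 : EqOn (fun z => (Φ.map (graphPt u z)).2.2)
      (fun z => v (fT (graphPt u z), fX (graphPt u z))) V := by
    intro z hz
    have := congrArg (fun p => p.2.2) (hT.map_graph z hz)
    exact this
  have hN1 : EqOn (pd (0, 1) (fun z => (Φ.map (graphPt u z)).2.2))
      (fun z => pd (0, 1) v (fT (graphPt u z), fX (graphPt u z))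
        * pd (0, 1, 0) fX (graphPt u z)) V := fun z hz => by
    rw [pd_congr hV hN0 _ hz, ((vD s0).2 z hz).2]
  have hN2 : EqOn (pd (0, 1) (pd (0, 1) (fun z => (Φ.map (graphPt u z)).2.2)))
      (fun z => (pd (0, 1) (pd (0, 1) v) (fT (graphPt u z), fX (graphPt u z))
        * pd (0, 1, 0) fX (graphPt u z)) * pd (0, 1, 0) fX (graphPt u z)
        + pd (0, 1) v (fT (graphPt u z), fX (graphPt u z))
        * pd (0, 1, 0) (pd (0, 1, 0) fX) (graphPt u z)) V := fun z hz => by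
    rw [pd_congr hV hN1 _ hz, pd_mul hV (vD s1).1 sχ _ hz]
    simp only
    rw [((vD s1).2 z hz).2, pd_comp_graphPt hO hV sXx huV hmem _ hz]
    simp only
    rw [X23 _ (hmem z hz)]; ring
  have cχ : pd (1, 0) (fun z => pd (0, 1, 0) fX (graphPt u z)) (t, x) = 0 := by
    rw [pd_comp_graphPt hO hV sXx huV hmem _ hzV]
    simp only
    rw [X21 _ (hmem _ hzV), X23 _ (hmem _ hzV)]; ring
  have cχ' : pd (1, 0) (fun z => pd (0, 1, 0) (pd (0, 1, 0) fX) (graphPt u z)) (t, x) = 0 := by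
    rw [pd_comp_graphPt hO hV sXxx huV hmem _ hzV]
    simp only
    rw [X221 _ (hmem _ hzV), X223 _ (hmem _ hzV)]; ring
  have e0 := pd_congr hV hN0 (1, 0) hzV
  rw [((vD s0).2 _ hzV).1] at e0
  have e1 := hN1 hzV
  have e2 := pd_congr hV hN1 (1, 0) hzV
  rw [pd_mul hV (vD s1).1 sχ _ hzV] at e2
  simp only at e2
  rw [((vD s1).2 _ hzV).1, cχ] at e2
  have e3 := pd_congr hV hN2 (1, 0) hzV
  rw [pd_add hV (((vD s2).1.mul sχ).mul sχ) ((vD s1).1.mul sχ') _ hzV] at e3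
  simp only at e3
  rw [pd_mul hV ((vD s2).1.mul sχ) sχ _ hzV, pd_mul hV (vD s1).1 sχ' _ hzV] at e3
  simp only at e3
  rw [pd_mul hV (vD s2).1 sχ _ hzV] at e3
  simp only at e3
  rw [((vD s2).2 _ hzV).1, ((vD s1).2 _ hzV).1, cχ, cχ'] at e3
  rw [e0, e2, e3]
  simp only at e1 ⊢
  rw [e1]
  have hnew : Φ.newPt u (t, x) = (fT (t, x, c), fX (t, x, c)) := by
    simp only [newPt, hg]; rfl
  have hv : v (fT (t, x, c), fX (t, x, c)) = (Φ.map (t, x, c)).2.2 := by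
    have := hN0 hzV
    simp only [hg] at this
    exact this.symm
  rw [hnew, hv] at hE'
  simp only at hE'
  rw [hg]
  -- With `N(t, x) = v(T, X)`, one has `X_x N_txx - X_xx N_tx = T_t X_x³ v_TXX`; the factor `T_t
  -- X_x³` is thus what removes all denominators.
  linear_combination (pd (0, 1, 0) fX (t, x, c)) ^ 3 * pd (1, 0, 0) fT (t, x, c) * hE'

end PointTransformation

/-! ### Determining equations and necessity of the criterion -/

namespace PointTransformation

/-- The new equation as an identity in the derivatives `a = u_t`, `b = u_x`, `k = u_xx` and
`q = u_tx` of a solution of the old one. -/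
theorem MapsEquation.jet_polynomial {Φ : PointTransformation} {E E' : Equation}
    (hM : Φ.MapsEquation E E') {p : ℝ × ℝ × ℝ} (hp : p ∈ Φ.dom) (a b k q : ℝ) :
    pd (0, 1, 0) (fun p => (Φ.map p).2.1) p ^ 3
        * (pd (1, 0, 0) (fun p => (Φ.map p).2.2) p + pd (0, 0, 1) (fun p => (Φ.map p).2.2) p * a)
      + pd (1, 0, 0) (fun p => (Φ.map p).1) p * pd (0, 1, 0) (fun p => (Φ.map p).2.1) p ^ 2
        * (E'.f (Φ.map p).1 + E'.g (Φ.map p).1 * (Φ.map p).2.2)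
        * (pd (0, 1, 0) (fun p => (Φ.map p).2.2) p + pd (0, 0, 1) (fun p => (Φ.map p).2.2) p * b)
      + E'.h (Φ.map p).1 * (pd (0, 1, 0) (fun p => (Φ.map p).2.1) p
        * ((pd (1, 0, 0) (pd (0, 1, 0) (pd (0, 1, 0) (fun p => (Φ.map p).2.2))) p
            + pd (0, 0, 1) (pd (0, 1, 0) (pd (0, 1, 0) (fun p => (Φ.map p).2.2))) p * a)
          + ((pd (1, 0, 0) (pd (0, 0, 1) (pd (0, 1, 0) (fun p => (Φ.map p).2.2))) p
              + pd (0, 0, 1) (pd (0, 0, 1) (pd (0, 1, 0) (fun p => (Φ.map p).2.2))) p * a) * b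
            + pd (0, 1, 0) (pd (0, 0, 1) (fun p => (Φ.map p).2.2)) p * q)
          + ((pd (1, 0, 0) (pd (0, 1, 0) (pd (0, 0, 1) (fun p => (Φ.map p).2.2))) p
              + pd (0, 0, 1) (pd (0, 1, 0) (pd (0, 0, 1) (fun p => (Φ.map p).2.2))) p * a
              + ((pd (1, 0, 0) (pd (0, 0, 1) (pd (0, 0, 1) (fun p => (Φ.map p).2.2))) p
                + pd (0, 0, 1) (pd (0, 0, 1) (pd (0, 0, 1) (fun p => (Φ.map p).2.2))) p * a) * b
                + pd (0, 0, 1) (pd (0, 0, 1) (fun p => (Φ.map p).2.2)) p * q)) * b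
            + (pd (0, 1, 0) (pd (0, 0, 1) (fun p => (Φ.map p).2.2)) p
              + pd (0, 0, 1) (pd (0, 0, 1) (fun p => (Φ.map p).2.2)) p * b) * q)
          + ((pd (1, 0, 0) (pd (0, 0, 1) (fun p => (Φ.map p).2.2)) p
              + pd (0, 0, 1) (pd (0, 0, 1) (fun p => (Φ.map p).2.2)) p * a) * k
            + pd (0, 0, 1) (fun p => (Φ.map p).2.2) p
              * (-(a + (E.f p.1 + E.g p.1 * p.2.2) * b) / E.h p.1)))
        - pd (0, 1, 0) (pd (0, 1, 0) (fun p => (Φ.map p).2.1)) p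
        * ((pd (1, 0, 0) (pd (0, 1, 0) (fun p => (Φ.map p).2.2)) p
            + pd (0, 1, 0) (pd (0, 0, 1) (fun p => (Φ.map p).2.2)) p * a)
          + (pd (1, 0, 0) (pd (0, 0, 1) (fun p => (Φ.map p).2.2)) p
            + pd (0, 0, 1) (pd (0, 0, 1) (fun p => (Φ.map p).2.2)) p * a) * b
          + pd (0, 0, 1) (fun p => (Φ.map p).2.2) p * q)) = 0 := by
  have hh : E.h p.1 ≠ 0 := E.h_ne_zero _ (hM.1 hp)
  have hcomm := pd_comm Φ.isOpen_dom Φ.smooth_U (0, 0, 1) (0, 1, 0) hp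
  obtain ⟨u, V, hV, hu, hz, hmem, hg, j1, j2, j3, j4, j5, hid⟩ := hM.jet_identity hp a b k q
  obtain ⟨J2, J3⟩ := pd_comp_graphPt_jet Φ.isOpen_dom hV Φ.smooth_U hu hmem hz
  have J0 := fun e => pd_comp_graphPt Φ.isOpen_dom hV Φ.smooth_U hu hmem e hz
  rw [J0, J0, J2, J3] at hid
  simp only [hg, j1, j2, j3, j4] at hid
  have j5' : pd (1, 0) (pd (0, 1) (pd (0, 1) u)) (p.1, p.2.1)
    = -(a + (E.f p.1 + E.g p.1 * p.2.2) * b) / E.h p.1 := by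
    rw [← j5]; field_simp
  rw [j5', hcomm] at hid
  exact hid

/-- The determining equations for the component `U` of a transformation between equations of the
class: those that come from the second-order derivatives of the unknown function. -/
theorem MapsEquation.determining_second {Φ : PointTransformation} {E E' : Equation}
    (hM : Φ.MapsEquation E E') {p : ℝ × ℝ × ℝ} (hp : p ∈ Φ.dom) :
    pd (1, 0, 0) (pd (0, 0, 1) (fun p => (Φ.map p).2.2)) p = 0 ∧
    pd (0, 0, 1) (pd (0, 0, 1) (fun p => (Φ.map p).2.2)) p = 0 ∧
    2 * pd (0, 1, 0) (fun p => (Φ.map p).2.1) p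
        * pd (0, 1, 0) (pd (0, 0, 1) (fun p => (Φ.map p).2.2)) p =
      pd (0, 1, 0) (pd (0, 1, 0) (fun p => (Φ.map p).2.1)) p
        * pd (0, 0, 1) (fun p => (Φ.map p).2.2) p := by
  have hh' : E'.h (Φ.map p).1 ≠ 0 := E'.h_ne_zero _ (hM.2.1 hp)
  obtain ⟨-, -, -, X2, -⟩ := hM.fiber_preserving hp
  have key := hM.jet_polynomial hp
  set F := fun p => (Φ.map p).2.2
  set F13 := pd (1, 0, 0) (pd (0, 0, 1) F) p
  set F33 := pd (0, 0, 1) (pd (0, 0, 1) F) p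
  set χ := pd (0, 1, 0) (fun p => (Φ.map p).2.1) p
  have hc : E'.h (Φ.map p).1 * χ ≠ 0 := mul_ne_zero hh' X2
  -- The coefficient of `u_xx` is a nonzero multiple of `U_tu + U_uu u_t`; the values `u_t = 0` and
  -- `u_t = 1` separate its two parts.
  have h13 : F13 = 0 := by
    refine (mul_eq_zero.1 (?_ : _ * F13 = 0)).resolve_left hc
    linear_combination key 0 0 1 0 - key 0 0 0 0
  have h33 : F33 = 0 := by
    refine (mul_eq_zero.1 (?_ : _ * F33 = 0)).resolve_left hc
    linear_combination key 1 0 1 0 - key 1 0 0 0 - E'.h (Φ.map p).1 * χ * h13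
  refine ⟨h13, h33, ?_⟩
  -- The coefficient of `u_tx` at `u_t = u_x = 0`.
  have : E'.h (Φ.map p).1 * (2 * χ * pd (0, 1, 0) (pd (0, 0, 1) F) p
    - pd (0, 1, 0) (pd (0, 1, 0) (fun p => (Φ.map p).2.1)) p * pd (0, 0, 1) F p) = 0 := by
    linear_combination key 0 0 0 1 - key 0 0 0 0
  have := (mul_eq_zero.1 this).resolve_left hh'
  linarith

/-- The determining equations for the component `U` of a transformation between equations of the
class: those that come from the first-order derivatives of the unknown function. -/
theorem MapsEquation.determining_first {Φ : PointTransformation} {E E' : Equation}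
    (hM : Φ.MapsEquation E E') {p : ℝ × ℝ × ℝ} (hp : p ∈ Φ.dom) :
    (pd (0, 1, 0) (fun p => (Φ.map p).2.1) p ^ 3 * pd (0, 0, 1) (fun p => (Φ.map p).2.2) p
      + E'.h (Φ.map p).1 * (pd (0, 1, 0) (fun p => (Φ.map p).2.1) p
        * (pd (0, 0, 1) (pd (0, 1, 0) (pd (0, 1, 0) (fun p => (Φ.map p).2.2))) p
          - pd (0, 0, 1) (fun p => (Φ.map p).2.2) p / E.h p.1)
        - pd (0, 1, 0) (pd (0, 1, 0) (fun p => (Φ.map p).2.1)) p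
          * pd (0, 1, 0) (pd (0, 0, 1) (fun p => (Φ.map p).2.2)) p) = 0) ∧
    E.h p.1 * pd (1, 0, 0) (fun p => (Φ.map p).1) p * pd (0, 1, 0) (fun p => (Φ.map p).2.1) p
        * (E'.f (Φ.map p).1 + E'.g (Φ.map p).1 * (Φ.map p).2.2)
      = E'.h (Φ.map p).1 * (E.f p.1 + E.g p.1 * p.2.2) ∧
    pd (0, 1, 0) (fun p => (Φ.map p).2.1) p ^ 3 * pd (1, 0, 0) (fun p => (Φ.map p).2.2) p
      + pd (1, 0, 0) (fun p => (Φ.map p).1) p * pd (0, 1, 0) (fun p => (Φ.map p).2.1) p ^ 2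
        * (E'.f (Φ.map p).1 + E'.g (Φ.map p).1 * (Φ.map p).2.2)
        * pd (0, 1, 0) (fun p => (Φ.map p).2.2) p
      + E'.h (Φ.map p).1 * (pd (0, 1, 0) (fun p => (Φ.map p).2.1) p
        * pd (1, 0, 0) (pd (0, 1, 0) (pd (0, 1, 0) (fun p => (Φ.map p).2.2))) p
        - pd (0, 1, 0) (pd (0, 1, 0) (fun p => (Φ.map p).2.1)) p
          * pd (1, 0, 0) (pd (0, 1, 0) (fun p => (Φ.map p).2.2)) p) = 0 := by
  have hh : E.h p.1 ≠ 0 := E.h_ne_zero _ (hM.1 hp)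
  obtain ⟨-, -, -, X2, U3⟩ := hM.fiber_preserving hp
  have hO := Φ.isOpen_dom
  have sU := Φ.smooth_U
  have sU3 := pd_smooth hO sU (0, 0, 1)
  have z13 := fun q (hq : q ∈ Φ.dom) => (hM.determining_second hq).1
  have z33 := fun q (hq : q ∈ Φ.dom) => (hM.determining_second hq).2.1
  have c32 := pd_comm hO sU (0, 0, 1) (0, 1, 0)
  have y133 := pd_zero_of_eqOn hO z33 (1, 0, 0) p hp
  have y333 := pd_zero_of_eqOn hO z33 (0, 0, 1) p hp
  have y132 : pd (1, 0, 0) (pd (0, 0, 1) (pd (0, 1, 0) (fun p => (Φ.map p).2.2))) p = 0 := by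
    rw [pd_congr hO c32 (1, 0, 0) hp, pd_comm hO sU3 _ _ hp]
    exact pd_zero_of_eqOn hO z13 (0, 1, 0) p hp
  have y332 : pd (0, 0, 1) (pd (0, 0, 1) (pd (0, 1, 0) (fun p => (Φ.map p).2.2))) p = 0 := by
    rw [pd_congr hO c32 (0, 0, 1) hp, pd_comm hO sU3 _ _ hp]
    exact pd_zero_of_eqOn hO z33 (0, 1, 0) p hp
  have y123 : pd (1, 0, 0) (pd (0, 1, 0) (pd (0, 0, 1) (fun p => (Φ.map p).2.2))) p = 0 := by
    rw [pd_comm hO sU3 _ _ hp]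
    exact pd_zero_of_eqOn hO z13 (0, 1, 0) p hp
  have y323 : pd (0, 0, 1) (pd (0, 1, 0) (pd (0, 0, 1) (fun p => (Φ.map p).2.2))) p = 0 := by
    rw [pd_comm hO sU3 _ _ hp]
    exact pd_zero_of_eqOn hO z33 (0, 1, 0) p hp
  -- With `U_tu = U_uu = 0` and their consequences, the identity is affine in `u_t = a` and `u_x =
  -- b`. The three claims are its coefficients of `a`, of `b`, and its constant term.
  have key := fun a b => hM.jet_polynomial hp a b 0 0
  simp only [y133, y333, y132, y332, y123, y323, z13 p hp, z33 p hp] at key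
  refine ⟨?_, ?_, ?_⟩
  · linear_combination key 1 0 - key 0 0
  · have h := key 0 1
    have h0 := key 0 0
    refine mul_left_cancel₀ (mul_ne_zero X2 U3) ?_
    have hinv : E.h p.1 * (E.h p.1)⁻¹ = 1 := mul_inv_cancel₀ hh
    simp only [div_eq_mul_inv] at h h0
    linear_combination E.h p.1 * (h - h0)
      + E'.h (Φ.map p).1 * (E.f p.1 + E.g p.1 * p.2.2) * pd (0, 1, 0) (fun p => (Φ.map p).2.1) p
        * pd (0, 0, 1) (fun p => (Φ.map p).2.2) p * hinv
  · linear_combination key 0 0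

/-- An equation that is mapped to one with constant coefficients satisfies the criterion over the
domain of the transformation. -/
theorem MapsEquation.criterion_at {Φ : PointTransformation} {E E' : Equation}
    (hM : Φ.MapsEquation E E') (hE' : E'.IsConstCoeff) {p : ℝ × ℝ × ℝ} (hp : p ∈ Φ.dom) :
    deriv (fun s => E.f s / E.g s) p.1 = 0 ∧ deriv E.h p.1 = 0 := by
  obtain ⟨α, β, γ, hconst⟩ := hE'
  have hc := fun q (hq : q ∈ Φ.dom) => hconst _ (hM.2.1 hq)
  have hβ : β ≠ 0 := by
    rw [← (hc p hp).2.1]; exact E'.g_ne_zero _ (hM.2.1 hp)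
  have hγ : γ ≠ 0 := by
    rw [← (hc p hp).2.2]; exact E'.h_ne_zero _ (hM.2.1 hp)
  have hO := Φ.isOpen_dom
  have fp := fun q (hq : q ∈ Φ.dom) => hM.fiber_preserving hq
  have d2 := fun q (hq : q ∈ Φ.dom) => hM.determining_second hq
  have d1 := fun q (hq : q ∈ Φ.dom) => hM.determining_first hq
  have hh := fun q (hq : q ∈ Φ.dom) => E.h_ne_zero _ (hM.1 hq)
  have hgn := fun q (hq : q ∈ Φ.dom) => E.g_ne_zero _ (hM.1 hq)
  obtain ⟨sf, df⟩ := pd_comp_fst E.isOpen_I E.smooth_f (fun q (hq : q ∈ Φ.dom) => hM.1 hq)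
  obtain ⟨sg, dg⟩ := pd_comp_fst E.isOpen_I E.smooth_g (fun q (hq : q ∈ Φ.dom) => hM.1 hq)
  obtain ⟨sh, dh⟩ := pd_comp_fst E.isOpen_I E.smooth_h (fun q (hq : q ∈ Φ.dom) => hM.1 hq)
  obtain ⟨sk, dk⟩ := pd_comp_fst (k := fun s => E.f s / E.g s) E.isOpen_I
    (E.smooth_f.div E.smooth_g E.g_ne_zero) (fun q (hq : q ∈ Φ.dom) => hM.1 hq)
  have sT1 := pd_smooth hO Φ.smooth_T (1, 0, 0)
  have sX2 := pd_smooth hO Φ.smooth_X (0, 1, 0)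
  have sU := Φ.smooth_U
  have sU3 := pd_smooth hO sU (0, 0, 1)
  have cT12 : ∀ q ∈ Φ.dom, pd (0, 1, 0) (pd (1, 0, 0) (fun p => (Φ.map p).1)) q = 0 :=
    fun q hq => by
      rw [pd_comm hO Φ.smooth_T _ _ hq]
      exact pd_zero_of_eqOn hO (fun q hq => (fp q hq).1.1) _ q hq
  have cT13 : ∀ q ∈ Φ.dom, pd (0, 0, 1) (pd (1, 0, 0) (fun p => (Φ.map p).1)) q = 0 :=
    fun q hq => by
      rw [pd_comm hO Φ.smooth_T _ _ hq]
      exact pd_zero_of_eqOn hO (fun q hq => (fp q hq).1.2) _ q hq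
  have cX21 : ∀ q ∈ Φ.dom, pd (1, 0, 0) (pd (0, 1, 0) (fun p => (Φ.map p).2.1)) q = 0 :=
    fun q hq => by
      rw [pd_comm hO Φ.smooth_X _ _ hq]
      exact pd_zero_of_eqOn hO (fun q hq => (fp q hq).2.1.1) _ q hq
  have cX23 : ∀ q ∈ Φ.dom, pd (0, 0, 1) (pd (0, 1, 0) (fun p => (Φ.map p).2.1)) q = 0 :=
    fun q hq => by
      rw [pd_comm hO Φ.smooth_X _ _ hq]
      exact pd_zero_of_eqOn hO (fun q hq => (fp q hq).2.1.2) _ q hq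
  set T1 := pd (1, 0, 0) (fun p => (Φ.map p).1)
  set X2 := pd (0, 1, 0) (fun p => (Φ.map p).2.1)
  set U : ℝ × ℝ × ℝ → ℝ := fun p => (Φ.map p).2.2
  set U3 := pd (0, 0, 1) U
  have hT1 := fun q hq => (fp q hq).2.2.1
  have hX2 := fun q hq => (fp q hq).2.2.2.1
  have hU3 := fun q hq => (fp q hq).2.2.2.2
  have sM : ContDiffOn ℝ ∞ (fun q : ℝ × ℝ × ℝ => E.h q.1 * T1 q) Φ.dom := sh.mul sT1
  have sMX := sM.mul sX2
  have sα : ∀ r : ℝ, ContDiffOn ℝ ∞ (fun _ : ℝ × ℝ × ℝ => r) Φ.dom := fun r => contDiffOn_const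
  have dα : ∀ (r : ℝ) e q, pd e (fun _ : ℝ × ℝ × ℝ => r) q = 0 := fun r e q => by simp [pd]
  have sβU := (sα β).mul sU
  have sLU := (sα α).add sβU
  have eqA : EqOn (fun q => E.h q.1 * T1 q * X2 q * (α + β * U q))
      (fun q => γ * (E.f q.1 + E.g q.1 * q.2.2)) Φ.dom := fun q hq => by
    have := (d1 q hq).2.1
    rw [(hc q hq).1, (hc q hq).2.1, (hc q hq).2.2] at this
    exact this
  have su : ContDiffOn ℝ ∞ (fun q : ℝ × ℝ × ℝ => q.2.2) Φ.dom := contDiff_snd.snd.contDiffOn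
  have du : ∀ (e q : ℝ × ℝ × ℝ), pd e (fun q : ℝ × ℝ × ℝ => q.2.2) q = e.2.2 := by
    intro e q
    have h : fderiv ℝ (fun q : ℝ × ℝ × ℝ => q.2.2) q = _ :=
      ((hasFDerivAt_snd (p := q)).snd).fderiv
    simp [pd, h]
  have dL : ∀ e, ∀ q ∈ Φ.dom, pd e (fun q => α + β * U q) q = β * pd e U q := by
    intro e q hq
    rw [pd_add hO (sα α) sβU e hq]; simp only
    rw [pd_mul hO (sα β) sU e hq]; simp [dα]
  have dR : ∀ e, ∀ q ∈ Φ.dom, pd e (fun q => γ * (E.f q.1 + E.g q.1 * q.2.2)) q =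
      γ * (deriv E.f q.1 * e.1 + deriv E.g q.1 * e.1 * q.2.2 + E.g q.1 * e.2.2) := by
    intro e q hq
    rw [pd_mul hO (sα γ) (sf.add (sg.mul su)) e hq]; simp only
    rw [pd_add hO sf (sg.mul su) e hq]; simp only
    rw [pd_mul hO sg su e hq]; simp only
    rw [df q hq, dg q hq, du, dα]; ring
  have dM : ∀ e, ∀ q ∈ Φ.dom, pd e (fun q : ℝ × ℝ × ℝ => E.h q.1 * T1 q * X2 q) q =
      (deriv E.h q.1 * e.1 * T1 q + E.h q.1 * pd e T1 q) * X2 q + E.h q.1 * T1 q * pd e X2 q := by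
    intro e q hq
    rw [pd_mul hO sM sX2 e hq]; simp only
    rw [pd_mul hO sh sT1 e hq]; simp only
    rw [dh q hq]
  have eqA' : ∀ e, ∀ q ∈ Φ.dom, pd e (fun q : ℝ × ℝ × ℝ => E.h q.1 * T1 q * X2 q) q
      * (α + β * U q) + E.h q.1 * T1 q * X2 q * (β * pd e U q) =
      γ * (deriv E.f q.1 * e.1 + deriv E.g q.1 * e.1 * q.2.2 + E.g q.1 * e.2.2) := by
    intro e q hq
    rw [← dR e q hq, ← pd_congr hO eqA e hq, pd_mul hO sMX sLU e hq]; simp only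
    rw [dL e q hq]
  -- The `u`-derivative of `eqA`; the prefactor `h T_t X_x` does not depend on `u`.
  have eqB : EqOn (fun q => E.h q.1 * T1 q * X2 q * U3 q) (fun q => (γ / β) * E.g q.1) Φ.dom := by
    intro q hq
    have h := eqA' (0, 0, 1) q hq
    rw [dM _ q hq, cT13 q hq, cX23 q hq] at h
    simp only at h ⊢
    field_simp
    linear_combination h
  have hX22 : ∀ q ∈ Φ.dom, pd (0, 1, 0) X2 q = 0 ∧ pd (0, 1, 0) U3 q = 0 := by
    intro q hq
    have h := pd_congr hO eqB (0, 1, 0) hq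
    rw [pd_mul hO sMX sU3 _ hq, pd_mul hO (sα (γ / β)) sg _ hq] at h
    simp only at h
    rw [dM _ q hq, cT12 q hq, dg q hq, dα] at h
    have h1 : (E.h q.1 * T1 q) * (pd (0, 1, 0) X2 q * U3 q + X2 q * pd (0, 1, 0) U3 q) = 0 := by
      linear_combination h
    have h2 := (mul_eq_zero.1 h1).resolve_left (mul_ne_zero (hh q hq) (hT1 q hq))
    have h3 := (d2 q hq).2.2
    -- The `x`-derivative of `eqB` gives `X_xx U_u + X_x U_xu = 0`, while the determining equation
    -- is `2 X_x U_xu = X_xx U_u`. Together they force both products to vanish.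
    have h4 : pd (0, 1, 0) X2 q * U3 q = 0 := by linear_combination (2 * h2 - h3) / 3
    have h5 := (mul_eq_zero.1 h4).resolve_right (hU3 q hq)
    refine ⟨h5, ?_⟩
    rw [h5] at h2
    exact (mul_eq_zero.1 (by linear_combination h2 : X2 q * pd (0, 1, 0) U3 q = 0)).resolve_left
      (hX2 q hq)
  have hU2 : ∀ q ∈ Φ.dom, pd (0, 1, 0) U q = 0 := by
    intro q hq
    have h := eqA' (0, 1, 0) q hq
    rw [dM _ q hq, cT12 q hq, (hX22 q hq).1] at h
    have h1 : (E.h q.1 * T1 q * X2 q * β) * pd (0, 1, 0) U q = 0 := by linear_combination h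
    exact (mul_eq_zero.1 h1).resolve_left
      (mul_ne_zero (mul_ne_zero (mul_ne_zero (hh q hq) (hT1 q hq)) (hX2 q hq)) hβ)
  have hU22 := pd_zero_of_eqOn hO hU2 (0, 1, 0)
  have hU1 : ∀ q ∈ Φ.dom, pd (1, 0, 0) U q = 0 := by
    intro q hq
    have h := (d1 q hq).2.2
    rw [hU2 q hq, (hX22 q hq).1, pd_zero_of_eqOn hO hU22 (1, 0, 0) q hq] at h
    have h1 : X2 q ^ 3 * pd (1, 0, 0) U q = 0 := by linear_combination h
    exact (mul_eq_zero.1 h1).resolve_left (pow_ne_zero _ (hX2 q hq))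
  have eqH : EqOn (fun q => E.h q.1 * (X2 q * X2 q)) (fun _ => γ) Φ.dom := by
    intro q hq
    have h := (d1 q hq).1
    rw [(hX22 q hq).1, pd_zero_of_eqOn hO hU22 (0, 0, 1) q hq, (hc q hq).2.2] at h
    have hinv : E.h q.1 * (E.h q.1)⁻¹ = 1 := mul_inv_cancel₀ (hh q hq)
    simp only [div_eq_mul_inv] at h ⊢
    refine mul_left_cancel₀ (mul_ne_zero (hX2 q hq) (hU3 q hq)) ?_
    linear_combination E.h q.1 * h + γ * X2 q * U3 q * hinv
  -- `eqA` divided by `eqB`, solved for `f/g`. Apart from `f/g`, nothing in it has a nonzero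
  -- `t`-derivative, because `U_t = U_tu = 0`.
  have eqK : EqOn (fun q => E.f q.1 / E.g q.1 * (β * U3 q))
      (fun q => (α + β * U q) - (β * U3 q) * q.2.2) Φ.dom := by
    intro q hq
    have h1 := eqA hq
    have h2 := eqB hq
    simp only at h1 h2 ⊢
    have hg := hgn q hq
    have h2' : E.h q.1 * T1 q * X2 q * (β * U3 q) = γ * E.g q.1 := by
      rw [mul_left_comm, h2]; field_simp
    have hne := mul_ne_zero (mul_ne_zero (hh q hq) (hT1 q hq)) (hX2 q hq)
    refine mul_left_cancel₀ (mul_ne_zero hne hg) ?_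
    have hk : E.f q.1 / E.g q.1 * E.g q.1 = E.f q.1 := div_mul_cancel₀ _ hg
    linear_combination (E.f q.1) * h2' - E.g q.1 * h1 + E.g q.1 * q.2.2 * h2'
      + E.h q.1 * T1 q * X2 q * (β * U3 q) * hk
  constructor
  · have h := pd_congr hO eqK (1, 0, 0) hp
    have sβ3 := (sα β).mul sU3
    rw [pd_mul hO sk sβ3 _ hp, pd_sub hO sLU (sβ3.mul su) _ hp] at h
    simp only at h
    rw [pd_mul hO sβ3 su _ hp, dL _ p hp] at h
    simp only at h
    rw [pd_mul hO (sα β) sU3 _ hp] at h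
    simp only at h
    rw [dk p hp, (d2 p hp).1, hU1 p hp, du, dα] at h
    have h1 : deriv (fun s => E.f s / E.g s) p.1 * (β * U3 p) = 0 := by linear_combination h
    exact (mul_eq_zero.1 h1).resolve_right (mul_ne_zero hβ (hU3 p hp))
  · have h := pd_congr hO eqH (1, 0, 0) hp
    rw [pd_mul hO sh (sX2.mul sX2) _ hp] at h
    simp only at h
    rw [pd_mul hO sX2 sX2 _ hp] at h
    simp only at h
    rw [dh p hp, cX21 p hp, dα] at h
    have h1 : deriv E.h p.1 * (X2 p * X2 p) = 0 := by linear_combination h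
    exact (mul_eq_zero.1 h1).resolve_right (mul_ne_zero (hX2 p hp) (hX2 p hp))

end PointTransformation

/-! ### Sufficiency of the criterion and the equivalences -/

namespace Equation

theorem LocallyReducible.criterion {E : Equation} (h : E.LocallyReducible) : E.Criterion := by
  intro t ht
  obtain ⟨E', Φ, hE', hM, x, u, hp⟩ := h t ht
  exact hM.criterion_at hE' hp

theorem Reducible.locallyReducible {E : Equation} (h : E.Reducible) : E.LocallyReducible := by
  obtain ⟨E', Φ, hE', hM, hdom, -⟩ := h
  exact fun t ht => ⟨E', Φ, hE', hM, 0, 0, by rw [hdom]; exact ht⟩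

theorem exists_const_of_deriv_eq_zero {I : Set ℝ} (hI : IsOpen I) (hI' : I.OrdConnected)
    {k : ℝ → ℝ} (hk : ContDiffOn ℝ ∞ k I) (hd : ∀ t ∈ I, deriv k t = 0) :
    ∃ c, ∀ t ∈ I, k t = c :=
  hI.exists_is_const_of_deriv_eq_zero hI'.isPreconnected (hk.differentiableOn (by simp))
    fun t ht => hd t ht

/-- Passing from vanishing derivatives to constants uses that `I` is connected. -/
theorem criterion_iff (E : Equation) : E.Criterion ↔
    (∃ c : ℝ, ∀ t ∈ E.I, E.h t = c) ∧ (∃ c : ℝ, ∀ t ∈ E.I, E.f t = c * E.g t) := by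
  constructor
  · intro h
    refine ⟨exists_const_of_deriv_eq_zero E.isOpen_I E.ordConnected_I E.smooth_h
      fun t ht => (h t ht).2, ?_⟩
    obtain ⟨c, hc⟩ := exists_const_of_deriv_eq_zero E.isOpen_I E.ordConnected_I
      (E.smooth_f.div E.smooth_g E.g_ne_zero) fun t ht => (h t ht).1
    exact ⟨c, fun t ht => (div_eq_iff (E.g_ne_zero t ht)).1 (hc t ht)⟩
  · rintro ⟨⟨c, hc⟩, d, hd⟩ t ht
    have hmem := E.isOpen_I.mem_nhds ht
    constructor
    · have : (fun s => E.f s / E.g s) =ᶠ[nhds t] fun _ => d :=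
        Filter.eventually_of_mem hmem fun s hs =>
          (div_eq_iff (E.g_ne_zero s hs)).2 (hd s hs)
      rw [this.deriv_eq, deriv_const]
    · have : E.h =ᶠ[nhds t] fun _ => c := Filter.eventually_of_mem hmem fun s hs => hc s hs
      rw [this.deriv_eq, deriv_const]

/-- The coefficient `g` has an antiderivative on `I`; it is a smooth change of the time variable. -/
theorem exists_primitive (E : Equation) : ∃ G : ℝ → ℝ, (∀ t ∈ E.I, HasDerivAt G (E.g t) t) ∧
    ContDiffOn ℝ ∞ G E.I ∧ InjOn G E.I ∧ IsOpen (G '' E.I) ∧ (G '' E.I).OrdConnected := by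
  have hG : ∃ G : ℝ → ℝ, ∀ t ∈ E.I, HasDerivAt G (E.g t) t := by
    -- The interval may be empty; then there is no base point for the integral and any function will
    -- do.
    rcases E.I.eq_empty_or_nonempty with h | ⟨t₀, ht₀⟩
    · exact ⟨fun _ => 0, by simp [h]⟩
    · refine ⟨fun t => ∫ s in t₀..t, E.g s, fun t ht => ?_⟩
      have hc : ContinuousOn E.g E.I := E.smooth_g.continuousOn
      exact intervalIntegral.integral_hasDerivAt_right
        (hc.mono (E.ordConnected_I.uIcc_subset ht₀ ht)).intervalIntegrable
        (hc.stronglyMeasurableAtFilter E.isOpen_I t ht) (hc.continuousAt (E.isOpen_I.mem_nhds ht))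
  obtain ⟨G, hG⟩ := hG
  have hGs : ContDiffOn ℝ ∞ G E.I := by
    refine ((contDiffOn_succ_iff_deriv_of_isOpen (n := ∞) E.isOpen_I).2
      ⟨fun t ht => (hG t ht).differentiableAt.differentiableWithinAt, by simp,
        E.smooth_g.congr fun t ht => (hG t ht).deriv⟩)
  have hcont : ContinuousOn G E.I := hGs.continuousOn
  refine ⟨G, hG, hGs, ?_, ?_, ?_⟩
  · have key : ∀ s ∈ E.I, ∀ t ∈ E.I, s < t → G s ≠ G t := by
      intro s hs t ht hst heq
      have hsub := E.ordConnected_I.out hs ht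
      obtain ⟨r, hr, hr'⟩ := exists_hasDerivAt_eq_zero hst (hcont.mono hsub) heq
        fun r hr => hG r (hsub (Ioo_subset_Icc_self hr))
      exact E.g_ne_zero r (hsub (Ioo_subset_Icc_self hr)) hr'
    intro s hs t ht heq
    rcases lt_trichotomy s t with h | h | h
    · exact absurd heq (key s hs t ht h)
    · exact h
    · exact absurd heq.symm (key t ht s hs h)
  · rw [isOpen_iff_mem_nhds]
    rintro _ ⟨t, ht, rfl⟩
    have hst : HasStrictDerivAt G (E.g t) t :=
      (hGs.contDiffAt (E.isOpen_I.mem_nhds ht)).hasStrictDerivAt' (hG t ht) (by simp)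
    rw [← hst.map_nhds_eq (E.g_ne_zero t ht)]
    exact Filter.image_mem_map (E.isOpen_I.mem_nhds ht)
  · exact (E.ordConnected_I.isPreconnected.image G hcont).ordConnected

/-- The new equation has coefficients `c`, `1`, `η` on `G(I)`, and the map is `(t, x, u) ↦ (G(t), x,
u)`. Since `u_t = g v_T` and `u_txx = g v_TXX`, the old left side is `g` times the new one. -/
theorem Criterion.reducible {E : Equation} (h : E.Criterion) : E.Reducible := by
  obtain ⟨⟨η, hη⟩, c, hc⟩ := E.criterion_iff.1 h
  obtain ⟨G, hG, hGs, hinj, hopen, hord⟩ := E.exists_primitive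
  let E' : Equation :=
    { I := G '' E.I
      isOpen_I := hopen
      ordConnected_I := hord
      f := fun _ => c
      g := fun _ => 1
      h := fun _ => η
      smooth_f := contDiffOn_const
      smooth_g := contDiffOn_const
      smooth_h := contDiffOn_const
      g_ne_zero := fun _ _ => one_ne_zero
      h_ne_zero := by
        rintro _ ⟨t, ht, rfl⟩
        rw [← hη t ht]; exact E.h_ne_zero t ht }
  have hopenS : IsOpen E.space := E.isOpen_I.preimage continuous_fst
  have hder : ∀ p ∈ E.space, HasFDerivAt (fun p : ℝ × ℝ × ℝ => (G p.1, p.2))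
      (((ContinuousLinearMap.toSpanSingleton ℝ (E.g p.1)).comp
        (ContinuousLinearMap.fst ℝ ℝ (ℝ × ℝ))).prod (ContinuousLinearMap.snd ℝ ℝ (ℝ × ℝ))) p :=
    fun p hp => ((hG p.1 hp).hasFDerivAt.comp p hasFDerivAt_fst).prodMk hasFDerivAt_snd
  let Φ : PointTransformation :=
    { dom := E.space
      isOpen_dom := hopenS
      map := fun p => (G p.1, p.2)
      smooth_map := (hGs.comp contDiffOn_fst fun p hp => hp).prodMk contDiffOn_snd
      injOn_map := by
        intro p hp q hq hpq
        obtain ⟨h1, h2⟩ := Prod.ext_iff.1 hpq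
        exact Prod.ext (hinj hp hq h1) h2
      jacobian_ne_zero := by
        intro p hp
        rw [(hder p hp).fderiv]
        have hg := E.g_ne_zero p.1 hp
        refine (LinearMap.isUnit_iff_isUnit_det _).1 ?_ |>.ne_zero
        rw [LinearMap.isUnit_iff_ker_eq_bot, LinearMap.ker_eq_bot']
        rintro ⟨a, b⟩ hab
        have h1 : a * E.g p.1 = 0 := congrArg Prod.fst hab
        have h2 : b = 0 := congrArg Prod.snd hab
        rw [h2, (mul_eq_zero.1 h1).resolve_right hg]; rfl }
  refine ⟨E', Φ, ⟨c, 1, η, fun t _ => ⟨rfl, rfl, rfl⟩⟩, ⟨subset_rfl, ?_, ?_⟩, rfl, ?_⟩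
  · exact fun p hp => mem_image_of_mem G hp
  · intro V u W v hT z hz
    have hV := hT.isOpen_source
    have hW := hT.isOpen_target
    have hI : ∀ z ∈ V, z.1 ∈ E.I := fun z hz => hT.graph_mem z hz
    have hm : ∀ z ∈ V, (G z.1, z.2) ∈ W := fun z hz => hT.newPt_mem z hz
    have sA : ContDiffOn ℝ ∞ (fun z : ℝ × ℝ => G z.1) V := hGs.comp contDiffOn_fst hI
    have sB : ContDiffOn ℝ ∞ (fun z : ℝ × ℝ => z.2) V := contDiffOn_snd
    have dA : ∀ e, ∀ z ∈ V, pd e (fun z : ℝ × ℝ => G z.1) z = E.g z.1 * e.1 := by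
      intro e z hz
      have h2 : fderiv ℝ (fun z : ℝ × ℝ => G z.1) z = _ :=
        ((hG z.1 (hI z hz)).hasFDerivAt.comp z hasFDerivAt_fst).fderiv
      simp only [pd, h2]
      simp [mul_comm]
    have D : ∀ {w : ℝ × ℝ → ℝ}, ContDiffOn ℝ ∞ w W → ∀ e, EqOn (pd e (fun z => w (G z.1, z.2)))
        (fun z => pd (1, 0) w (G z.1, z.2) * (E.g z.1 * e.1) + pd (0, 1) w (G z.1, z.2) * e.2)
        V := by
      intro w hw e z hz
      rw [pd_comp_pair hV hW hw sA sB hm e hz]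
      simp only
      rw [dA e z hz, pd_snd]
    have Dx : ∀ {w : ℝ × ℝ → ℝ}, ContDiffOn ℝ ∞ w W → EqOn (pd (0, 1) (fun z => w (G z.1, z.2)))
        (fun z => pd (0, 1) w (G z.1, z.2)) V := fun hw z hz => by
      rw [D hw _ hz]; simp
    have h0 : EqOn u (fun z => v (G z.1, z.2)) V := fun z hz =>
      congrArg (fun p => p.2.2) (hT.map_graph z hz)
    have sv := hT.smooth_target
    have sv1 := pd_smooth hW sv (0, 1)
    have sv2 := pd_smooth hW sv1 (0, 1)
    have h1 := (pd_congr hV h0 (0, 1)).trans (Dx sv)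
    have h2 := (pd_congr hV h1 (0, 1)).trans (Dx sv1)
    have h3 := (pd_congr hV h2 (1, 0)).trans (D sv2 (1, 0))
    have ht := (pd_congr hV h0 (1, 0)).trans (D sv (1, 0))
    rw [holdsAt_iff_pd E hV hT.smooth_source hz, holdsAt_iff_pd E' hW sv (hT.newPt_mem z hz)]
    change _ ↔ pd (1, 0) v (G z.1, z.2) + c * pd (0, 1) v (G z.1, z.2)
      + 1 * v (G z.1, z.2) * pd (0, 1) v (G z.1, z.2)
      + η * pd (1, 0) (pd (0, 1) (pd (0, 1) v)) (G z.1, z.2) = 0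
    rw [ht hz, h3 hz, h1 hz, h0 hz, hc _ (hI z hz), hη _ (hI z hz)]
    simp only
    rw [← mul_right_inj' (E.g_ne_zero _ (hI z hz)) (b := pd (1, 0) v (G z.1, z.2) + _ + _ + _)]
    constructor <;> intro h <;> linear_combination h
  · ext ⟨s, y⟩
    constructor
    · rintro ⟨p, hp, hpy⟩
      exact ⟨p.1, hp, congrArg Prod.fst hpy⟩
    · rintro ⟨t, ht, hts⟩
      exact ⟨(t, y), ht, Prod.ext hts rfl⟩

end Equation
end BBM

theorem proposition1 (E : BBM.Equation) :
    (E.Reducible ↔ E.Criterion) ∧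
    (E.LocallyReducible ↔ E.Criterion) ∧
    (E.Criterion ↔
      (∃ c : ℝ, ∀ t ∈ E.I, E.h t = c) ∧ (∃ c : ℝ, ∀ t ∈ E.I, E.f t = c * E.g t)) :=
  ⟨⟨fun h => h.locallyReducible.criterion, fun h => h.reducible⟩,
    ⟨fun h => h.criterion, fun h => h.reducible.locallyReducible⟩, E.criterion_iff⟩
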